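/- Fix $\alpha>0$. Let $AP(\mathbb R)$ be the space of (Bohr) almost periodic functions, i.e. of continuous $f:\mathbb R\to\mathbb C$ such that for every $\varepsilon>0$ there is $L>0$ for which every interval of length greater than $L$ contains some $\tau$ with $\sup_t|f(t+\tau)-f(t)|\le\varepsilon$. Let $AP_2(\mathbb R)$ be the Hilbert space obtained by completing $AP(\mathbb R)$ with respect to the norm of the inner product $(f,g)_{AP}=\lim_{T\to\infty}\frac1{2T}\int_{-T}^{T}f(t)\overline{g(t)}\,dt$, and write $(\cdot,\cdot)_{AP_2}$ for its inner product. Let $AP(\mathbb Z)$ be the space of almost periodic sequences, i.e. of $a:\mathbb Z\to\mathbb C$ such that for every $\varepsilon>0$ there is $N$ for which any $N$ consecutive integers contain some $p$ with $\sup_n|a_{n+p}-a_n|\le\varepsilon$, with the norm given by $\|a\|_{AP(\mathbb Z)}^2=\lim_{p\to\infty}\frac1{2p}\sum_{n=-p}^{p}|a_n|^2$. For $\psi\in L^1(\mathbb R)$ put $\widehat\psi(\lambda)=\int_{\mathbb R}\psi(t)e^{-i\lambda t}\,dt$, $T_x\psi(t)=\psi(t-x)$ and $\langle f,T_x\psi\rangle=\int_{\mathbb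 R}f(t)\overline{\psi(t-x)}\,dt$. Let $W_0$ be the space of continuous functions $\varphi$ on $\mathbb R$ with $\sum_{k\in\mathbb Z}\operatorname{ess\,sup}_{x\in[0,1]}|\varphi(x-k)|<\infty$, and $\widehat{W_0}=\{\widehat\varphi:\varphi\in W_0\}$. **Theorem.** Let $\psi\in L^1(\mathbb R)$ satisfy $$\sup_{\lambda\in\mathbb R}\ \sum_{p\in\mathbb Z}\Big|\widehat\psi\Big(\lambda+\frac{2\pi}{\alpha}p\Big)\Big|^2<\infty .$$ Then there is an orthogonal system $(h_\lambda)_{\lambda\in[0,2\pi/\alpha)}$ in $AP_2(\mathbb R)$ (that is, a family of pairwise orthogonal elements, some of which may be $0$) such that (a) for every $f\in AP(\mathbb R)$ the sequence $(\langle f,T_{k\alpha}\psi\rangle)_{k\in\mathbb Z}$ belongs to $AP(\mathbb Z)$ and $$\big\|(\langle f,T_{k\alpha}\psi\rangle)_{k\in\mathbb Z}\big\|_{AP(\mathbb Z)}^2=\sum_{\lambda\in[0,2\pi/\alpha)}\big|(f,h_\lambda)_{AP_2}\big|^2 ;$$ (b) if moreover $\psi\in W_0\cup\widehat{W_0}$,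 then each $h_\lambda$ belongs to $AP(\mathbb R)$ (as a subspace of $AP_2(\mathbb R)$). -/

import Mathlib

open MeasureTheory Filter Topology

noncomputable section

/-! Bohr almost periodic functions -/

/-- `f : ℝ → ℂ` is (Bohr) almost periodic: it is continuous and for every `ε > 0` there is `L > 0`
such that every interval of length greater than `L` contains an `ε`-almost period of `f`. -/
def IsBohrAP (f : ℝ → ℂ) : Prop :=
  Continuous f ∧ ∀ ε : ℝ, 0 < ε → ∃ L : ℝ, 0 < L ∧ ∀ a b : ℝ, L < b - a →
    ∃ τ ∈ Set.Ioo a b, ∀ t : ℝ, ‖f (t + τ) - f t‖ ≤ ε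

theorem IsBohrAP.bounded {f : ℝ → ℂ} (hf : IsBohrAP f) : ∃ M : ℝ, 0 < M ∧ ∀ t, ‖f t‖ ≤ M := by
  obtain ⟨L, hL, h⟩ := hf.2 1 one_pos
  obtain ⟨M, hM⟩ := (isCompact_Icc (a := (0 : ℝ)) (b := L + 1)).exists_bound_of_continuousOn
    hf.1.continuousOn
  have hM0 : 0 ≤ M := (norm_nonneg _).trans (hM 0 ⟨le_rfl, by linarith⟩)
  refine ⟨M + 1, by linarith, fun t => ?_⟩
  obtain ⟨τ, hτ, hp⟩ := h (-t) (-t + L + 1) (by linarith)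
  have h1 := hM (t + τ) ⟨by linarith [hτ.1], by linarith [hτ.2]⟩
  have h2 := hp t
  have h3 : ‖f t‖ ≤ ‖f (t + τ)‖ + ‖f (t + τ) - f t‖ := by
    have := norm_sub_le (f (t + τ)) (f (t + τ) - f t)
    simpa using this
  linarith

theorem IsBohrAP.uniformContinuous {f : ℝ → ℂ} (hf : IsBohrAP f) (ε : ℝ) (hε : 0 < ε) :
    ∃ δ : ℝ, 0 < δ ∧ ∀ x y : ℝ, |x - y| < δ → ‖f x - f y‖ ≤ ε := by
  obtain ⟨L, hL, h⟩ := hf.2 (ε / 3) (by linarith)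
  have hu := (isCompact_Icc (a := (-1 : ℝ)) (b := L + 2)).uniformContinuousOn_of_continuous
    hf.1.continuousOn
  obtain ⟨δ, hδ, hu⟩ := Metric.uniformContinuousOn_iff.1 hu (ε / 3) (by linarith)
  refine ⟨min δ 1, lt_min hδ one_pos, fun x y hxy => ?_⟩
  have hxy1 := abs_lt.1 (hxy.trans_le (min_le_right _ _))
  obtain ⟨τ, hτ, hp⟩ := h (-x) (-x + L + 1) (by linarith)
  have h1 := hu (x + τ) ⟨by linarith [hτ.1], by linarith [hτ.2]⟩
    (y + τ) ⟨by linarith [hτ.1], by linarith [hτ.2]⟩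
    (by rw [Real.dist_eq]; simpa using hxy.trans_le (min_le_left _ _))
  rw [dist_eq_norm] at h1
  have h2 := hp x
  have h3 := hp y
  have h4 : f x - f y = (f (x + τ) - f (y + τ)) - (f (x + τ) - f x) + (f (y + τ) - f y) := by ring
  rw [h4]
  have h5 := norm_add_le ((f (x + τ) - f (y + τ)) - (f (x + τ) - f x)) (f (y + τ) - f y)
  have h6 := norm_sub_le (f (x + τ) - f (y + τ)) (f (x + τ) - f x)
  linarith

/-- The translates of an almost periodic function are totally bounded in the uniform norm. -/
theorem IsBohrAP.finite_translates {f : ℝ → ℂ} (hf : IsBohrAP f) (ε : ℝ) (hε : 0 < ε) :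
    ∃ F : Set ℝ, F.Finite ∧ ∀ s : ℝ, ∃ r ∈ F, ∀ t, ‖f (t + s) - f (t + r)‖ ≤ ε := by
  obtain ⟨L, hL, h⟩ := hf.2 (ε / 2) (by linarith)
  obtain ⟨δ, hδ, hu⟩ := hf.uniformContinuous (ε / 2) (by linarith)
  obtain ⟨F, -, hF, hcov⟩ := (isCompact_Icc (a := (0 : ℝ)) (b := L + 1)).finite_cover_balls hδ
  refine ⟨F, hF, fun s => ?_⟩
  obtain ⟨τ, hτ, hp⟩ := h (-s) (-s + L + 1) (by linarith)
  have hmem : s + τ ∈ Set.Icc 0 (L + 1) := ⟨by linarith [hτ.1], by linarith [hτ.2]⟩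
  obtain ⟨r, hr, hb⟩ := Set.mem_iUnion₂.1 (hcov hmem)
  refine ⟨r, hr, fun t => ?_⟩
  have h1 := hp (t + s)
  have h2 := hu (t + (s + τ)) (t + r) (by
    rw [Metric.mem_ball, Real.dist_eq] at hb
    simpa using hb)
  have h3 : f (t + s) - f (t + r)
      = (f (t + (s + τ)) - f (t + r)) - (f (t + s + τ) - f (t + s)) := by
    rw [← add_assoc]; ring
  rw [h3]
  exact (norm_sub_le _ _).trans (by linarith)

/-- Two almost periodic functions have a relatively dense set of common almost periods. -/
theorem IsBohrAP.common {f g : ℝ → ℂ} (hf : IsBohrAP f) (hg : IsBohrAP g) (ε : ℝ) (hε : 0 < ε) :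
    ∃ L : ℝ, 0 < L ∧ ∀ a b : ℝ, L < b - a →
      ∃ τ ∈ Set.Ioo a b, (∀ t : ℝ, ‖f (t + τ) - f t‖ ≤ ε) ∧ ∀ t : ℝ, ‖g (t + τ) - g t‖ ≤ ε := by
  obtain ⟨F, hF, h1⟩ := hf.finite_translates (ε / 2) (by linarith)
  obtain ⟨G, hG, h2⟩ := hg.finite_translates (ε / 2) (by linarith)
  choose p hp hp' using h1
  choose q hq hq' using h2
  have hfin : (Set.range fun s => (p s, q s)).Finite :=
    (hF.prod hG).subset (by rintro _ ⟨s, rfl⟩; exact ⟨hp s, hq s⟩)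
  -- one representative in each nonempty class
  let c : ℝ × ℝ → ℝ := fun z => Function.invFun (fun s => (p s, q s)) z
  have hc : ∀ s, (p (c (p s, q s)), q (c (p s, q s))) = (p s, q s) := fun s =>
    Function.invFun_eq (f := fun s => (p s, q s)) ⟨s, rfl⟩
  obtain ⟨R, hR⟩ := (hfin.image c).isBounded.exists_norm_le
  have hR' : ∀ s, |c (p s, q s)| ≤ R := fun s => hR _ ⟨_, ⟨s, rfl⟩, rfl⟩
  have hR0 : 0 ≤ R := (abs_nonneg _).trans (hR' 0)
  refine ⟨2 * R + 1, by linarith, fun a b hab => ?_⟩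
  set s := (a + b) / 2 with hs
  set r := c (p s, q s) with hr
  have hpr : p r = p s := congrArg Prod.fst (hc s)
  have hqr : q r = q s := congrArg Prod.snd (hc s)
  have hrb := abs_le.1 (hR' s)
  refine ⟨s - r, ⟨by linarith, by linarith⟩, fun t => ?_, fun t => ?_⟩
  · have e1 := hp' s (t - r)
    have e2 := hp' r (t - r)
    rw [hpr] at e2
    have e3 : f (t + (s - r)) - f t
        = (f (t - r + s) - f (t - r + p s)) - (f (t - r + r) - f (t - r + p s)) := by
      rw [show t - r + r = t by ring, show t + (s - r) = t - r + s by ring]; ring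
    rw [e3]
    exact (norm_sub_le _ _).trans (by linarith)
  · have e1 := hq' s (t - r)
    have e2 := hq' r (t - r)
    rw [hqr] at e2
    have e3 : g (t + (s - r)) - g t
        = (g (t - r + s) - g (t - r + q s)) - (g (t - r + r) - g (t - r + q s)) := by
      rw [show t - r + r = t by ring, show t + (s - r) = t - r + s by ring]; ring
    rw [e3]
    exact (norm_sub_le _ _).trans (by linarith)

theorem IsBohrAP.add {f g : ℝ → ℂ} (hf : IsBohrAP f) (hg : IsBohrAP g) : IsBohrAP (f + g) := by
  refine ⟨hf.1.add hg.1, fun ε hε => ?_⟩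
  obtain ⟨L, hL, h⟩ := hf.common hg (ε / 2) (by linarith)
  refine ⟨L, hL, fun a b hab => ?_⟩
  obtain ⟨τ, hτ, h1, h2⟩ := h a b hab
  refine ⟨τ, hτ, fun t => ?_⟩
  have e : (f + g) (t + τ) - (f + g) t = (f (t + τ) - f t) + (g (t + τ) - g t) := by
    simp only [Pi.add_apply]; ring
  rw [e]
  exact (norm_add_le _ _).trans (by linarith [h1 t, h2 t])

theorem IsBohrAP.mul {f g : ℝ → ℂ} (hf : IsBohrAP f) (hg : IsBohrAP g) : IsBohrAP (f * g) := by
  refine ⟨hf.1.mul hg.1, fun ε hε => ?_⟩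
  obtain ⟨M, hM, hMf⟩ := hf.bounded
  obtain ⟨N, hN, hNg⟩ := hg.bounded
  obtain ⟨L, hL, h⟩ := hf.common hg (ε / (M + N)) (by positivity)
  refine ⟨L, hL, fun a b hab => ?_⟩
  obtain ⟨τ, hτ, h1, h2⟩ := h a b hab
  refine ⟨τ, hτ, fun t => ?_⟩
  have e : (f * g) (t + τ) - (f * g) t
      = f (t + τ) * (g (t + τ) - g t) + (f (t + τ) - f t) * g t := by
    simp only [Pi.mul_apply]; ring
  have h3 : M * (ε / (M + N)) + ε / (M + N) * N = ε := by field_simp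
  rw [e]
  refine (norm_add_le _ _).trans ?_
  rw [norm_mul, norm_mul, ← h3]
  have := h1 t
  have := h2 t
  have := hMf (t + τ)
  have := hNg t
  gcongr

theorem isBohrAP_const (c : ℂ) : IsBohrAP fun _ => c := by
  refine ⟨continuous_const, fun ε hε => ⟨1, one_pos, fun a b hab => ⟨(a + b) / 2, ?_, ?_⟩⟩⟩
  · exact ⟨by linarith, by linarith⟩
  · intro t; simpa using hε.le

theorem IsBohrAP.star {f : ℝ → ℂ} (hf : IsBohrAP f) :
    IsBohrAP fun t => (starRingEnd ℂ) (f t) := by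
  refine ⟨Complex.continuous_conj.comp hf.1, fun ε hε => ?_⟩
  obtain ⟨L, hL, h⟩ := hf.2 ε hε
  refine ⟨L, hL, fun a b hab => ?_⟩
  obtain ⟨τ, hτ, h1⟩ := h a b hab
  refine ⟨τ, hτ, fun t => ?_⟩
  rw [← map_sub, RCLike.norm_conj]
  exact h1 t

/-! The mean value -/

/-- The mean `lim_{T → ∞} (2T)⁻¹ ∫_{-T}^{T} f`. -/
def apMean (f : ℝ → ℂ) : ℂ :=
  limUnder atTop fun T : ℝ => ((2 * T)⁻¹ : ℝ) • ∫ t in (-T)..T, f t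

theorem IsBohrAP.integral_shift {f : ℝ → ℂ} (hf : IsBohrAP f) (ε : ℝ) (hε : 0 < ε) :
    ∃ K : ℝ, 0 < K ∧ ∀ s T : ℝ, 0 ≤ T →
      ‖(∫ t in s..(s + T), f t) - ∫ t in (0 : ℝ)..T, f t‖ ≤ ε * T + K := by
  obtain ⟨M, hM, hMf⟩ := hf.bounded
  obtain ⟨L, hL, h⟩ := hf.2 ε hε
  have hi : ∀ a b : ℝ, IntervalIntegrable f volume a b := fun a b => hf.1.intervalIntegrable a b
  refine ⟨2 * (M * (L + 1)), by positivity, fun s T hT => ?_⟩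
  obtain ⟨τ, hτ, hp⟩ := h s (s + L + 1) (by linarith)
  have e1 : (∫ t in s..(s + T), f t) - ∫ t in (0 : ℝ)..T, f t
      = (∫ t in s..τ, f t) - (∫ t in (s + T)..(τ + T), f t)
        + ∫ t in (0 : ℝ)..T, (f (t + τ) - f t) := by
    have a1 : ∫ t in (0 : ℝ)..T, (f (t + τ) - f t)
        = (∫ t in τ..(τ + T), f t) - ∫ t in (0 : ℝ)..T, f t := by
      rw [intervalIntegral.integral_sub
        (Continuous.intervalIntegrable (u := fun t => f (t + τ))
          (hf.1.comp (by fun_prop)) _ _) (hi _ _),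
        intervalIntegral.integral_comp_add_right, zero_add, add_comm T τ]
    have a2 := intervalIntegral.integral_add_adjacent_intervals (hi s τ) (hi τ (τ + T))
    have a3 := intervalIntegral.integral_add_adjacent_intervals (hi s (s + T)) (hi (s + T) (τ + T))
    rw [a1, eq_sub_of_add_eq a3, ← a2]
    ring
  have b1 : ‖∫ t in s..τ, f t‖ ≤ M * (L + 1) := by
    refine (intervalIntegral.norm_integral_le_of_norm_le_const fun t _ => hMf t).trans ?_
    rw [abs_of_pos (by linarith [hτ.1])]
    gcongr
    linarith [hτ.2]
  have b2 : ‖∫ t in (s + T)..(τ + T), f t‖ ≤ M * (L + 1) := by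
    refine (intervalIntegral.norm_integral_le_of_norm_le_const fun t _ => hMf t).trans ?_
    rw [abs_of_pos (by linarith [hτ.1])]
    gcongr
    linarith [hτ.2]
  have b3 : ‖∫ t in (0 : ℝ)..T, (f (t + τ) - f t)‖ ≤ ε * T := by
    refine (intervalIntegral.norm_integral_le_of_norm_le_const fun t _ => hp t).trans ?_
    rw [sub_zero, abs_of_nonneg hT]
  rw [e1]
  refine (norm_add_le _ _).trans ?_
  have := norm_sub_le (∫ t in s..τ, f t) (∫ t in (s + T)..(τ + T), f t)
  linarith

theorem IsBohrAP.integral_large {f : ℝ → ℂ} (hf : IsBohrAP f) (ε : ℝ) (hε : 0 < ε) :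
    ∃ c : ℂ, ∃ K : ℝ, 0 < K ∧ ∀ S : ℝ, 0 < S →
      ‖(∫ t in (-S)..S, f t) - ((2 * S : ℝ) : ℂ) * c‖ ≤ ε * (2 * S) + K := by
  obtain ⟨M, hM, hMf⟩ := hf.bounded
  obtain ⟨K, hK, h⟩ := hf.integral_shift (ε / 3) (by linarith)
  have hi : ∀ a b : ℝ, IntervalIntegrable f volume a b := fun a b => hf.1.intervalIntegrable a b
  set T : ℝ := 3 * K / ε with hT
  have hT0 : 0 < T := by positivity
  have hKT : K = ε / 3 * T := by rw [hT]; field_simp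
  set I : ℂ := ∫ t in (0 : ℝ)..T, f t with hI
  have hIn : ‖I‖ ≤ M * T := by
    refine (intervalIntegral.norm_integral_le_of_norm_le_const fun t _ => hMf t).trans ?_
    rw [sub_zero, abs_of_pos hT0]
  have hstep : ∀ n : ℕ, ‖(∫ t in (0 : ℝ)..(n * T), f t) - n * I‖ ≤ n * (ε / 3 * T + K) := by
    intro n
    induction n with
    | zero => simp
    | succ n ih =>
      have a := intervalIntegral.integral_add_adjacent_intervals (hi 0 (n * T))
        (hi (n * T) (n * T + T))
      have b := h (n * T) T hT0.le
      have e : ((n + 1 : ℕ) : ℝ) * T = n * T + T := by push_cast; ring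
      rw [e, ← a]
      have e2 : (∫ t in (0 : ℝ)..(n * T), f t) + (∫ t in (n * T)..(n * T + T), f t)
          - ((n + 1 : ℕ) : ℂ) * I = ((∫ t in (0 : ℝ)..(n * T), f t) - n * I)
            + ((∫ t in (n * T)..(n * T + T), f t) - I) := by push_cast; ring
      rw [e2]
      refine (norm_add_le _ _).trans ?_
      push_cast
      linarith
  refine ⟨I / T, K + 2 * (M * T), by positivity, fun S hS => ?_⟩
  set n : ℕ := ⌊2 * S / T⌋₊ with hn
  have hn1 : (n : ℝ) * T ≤ 2 * S := by
    have := Nat.floor_le (show 0 ≤ 2 * S / T by positivity)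
    rwa [le_div_iff₀ hT0] at this
  have hn2 : 2 * S < (n + 1) * T := by
    have := Nat.lt_floor_add_one (2 * S / T)
    rwa [div_lt_iff₀ hT0] at this
  have c1 := h (-S) (2 * S) (by positivity)
  rw [show -S + 2 * S = S by ring] at c1
  have c2 := hstep n
  have c3 : ‖∫ t in (n * T)..(2 * S), f t‖ ≤ M * T := by
    refine (intervalIntegral.norm_integral_le_of_norm_le_const fun t _ => hMf t).trans ?_
    rw [abs_of_nonneg (by linarith)]
    gcongr
    linarith
  have c4 : ‖((n : ℝ) - 2 * S / T : ℝ) * I‖ ≤ M * T := by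
    rw [norm_mul, Complex.norm_real, Real.norm_eq_abs]
    have : |(n : ℝ) - 2 * S / T| ≤ 1 := by
      rw [abs_le]
      constructor
      · linarith [Nat.lt_floor_add_one (2 * S / T)]
      · linarith [Nat.floor_le (show 0 ≤ 2 * S / T by positivity)]
    calc _ ≤ 1 * (M * T) := by gcongr
      _ = _ := one_mul _
  have c5 := intervalIntegral.integral_add_adjacent_intervals (hi 0 (n * T)) (hi (n * T) (2 * S))
  have hTc : (T : ℂ) ≠ 0 := by exact_mod_cast hT0.ne'
  have e : (∫ t in (-S)..S, f t) - ((2 * S : ℝ) : ℂ) * (I / T)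
      = ((∫ t in (-S)..S, f t) - ∫ t in (0 : ℝ)..(2 * S), f t)
        + ((∫ t in (0 : ℝ)..(n * T), f t) - n * I) + (∫ t in (n * T)..(2 * S), f t)
        + ((n : ℝ) - 2 * S / T : ℝ) * I := by
    rw [← c5]
    push_cast
    field_simp
    ring
  rw [e]
  refine (norm_add_le _ _).trans ?_
  refine (add_le_add_left (norm_add_le _ _) _).trans ?_
  refine (add_le_add_left (add_le_add_left (norm_add_le _ _) _) _).trans ?_
  have c6 : (n : ℝ) * (ε / 3 * T + K) ≤ 2 * ε / 3 * (2 * S) := by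
    have : (n : ℝ) * (ε / 3 * T + K) = 2 * ε / 3 * (n * T) := by rw [hKT]; ring
    rw [this]
    gcongr
  linarith

/-- The mean value of an almost periodic function exists. -/
theorem IsBohrAP.tendsto_mean {f : ℝ → ℂ} (hf : IsBohrAP f) :
    Tendsto (fun T : ℝ => ((2 * T)⁻¹ : ℝ) • ∫ t in (-T)..T, f t) atTop (𝓝 (apMean f)) := by
  refine tendsto_nhds_limUnder ?_
  refine cauchy_map_iff_exists_tendsto.1 (Metric.cauchy_iff.2 ⟨inferInstance, fun ε hε => ?_⟩)
  obtain ⟨c, K, hK, h⟩ := hf.integral_large (ε / 6) (by linarith)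
  refine ⟨_, image_mem_map (Ioi_mem_atTop (6 * K / ε)), ?_⟩
  have key : ∀ S ∈ Set.Ioi (6 * K / ε),
      ‖((2 * S)⁻¹ : ℝ) • (∫ t in (-S)..S, f t) - c‖ ≤ ε / 3 := by
    intro S hS
    rw [Set.mem_Ioi, div_lt_iff₀ hε] at hS
    have hS0 : 0 < S := by
      by_contra hneg
      nlinarith
    have hb := h S hS0
    have hSc : (S : ℂ) ≠ 0 := by exact_mod_cast hS0.ne'
    have e : ((2 * S)⁻¹ : ℝ) • (∫ t in (-S)..S, f t) - c
        = (((2 * S)⁻¹ : ℝ) : ℂ) * ((∫ t in (-S)..S, f t) - ((2 * S : ℝ) : ℂ) * c) := by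
      rw [Complex.real_smul]
      push_cast
      field_simp
    rw [e, norm_mul, Complex.norm_real, Real.norm_eq_abs, abs_of_pos (by positivity),
      inv_mul_le_iff₀ (by positivity)]
    nlinarith
  rintro _ ⟨x, hx, rfl⟩ _ ⟨y, hy, rfl⟩
  rw [dist_eq_norm]
  have e : ((2 * x)⁻¹ : ℝ) • (∫ t in (-x)..x, f t) - ((2 * y)⁻¹ : ℝ) • (∫ t in (-y)..y, f t)
      = (((2 * x)⁻¹ : ℝ) • (∫ t in (-x)..x, f t) - c)
        - (((2 * y)⁻¹ : ℝ) • (∫ t in (-y)..y, f t) - c) := by ring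
  refine lt_of_eq_of_lt (congrArg norm e) ((norm_sub_le _ _).trans_lt ?_)
  have h1 := key x hx
  have h2 := key y hy
  linarith

/-! The spaces `AP(ℝ)` and `AP₂(ℝ)` -/

/-- The almost periodic functions as a linear subspace of all functions. -/
def apSubmodule : Submodule ℂ (ℝ → ℂ) where
  carrier := {f | IsBohrAP f}
  add_mem' hf hg := hf.add hg
  zero_mem' := isBohrAP_const 0
  smul_mem' c _ hf := (isBohrAP_const c).mul hf

/-- The space `AP(ℝ)` of almost periodic functions; it carries the inner product
`(f, g) = lim_{T → ∞} (2T)⁻¹ ∫_{-T}^{T} f ḡ`. -/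
def APReal : Type := apSubmodule

namespace APReal

instance : AddCommGroup APReal := inferInstanceAs (AddCommGroup apSubmodule)

instance : Module ℂ APReal := inferInstanceAs (Module ℂ apSubmodule)

instance : CoeFun APReal fun _ => ℝ → ℂ := ⟨fun f => f.1⟩

theorem isBohrAP (f : APReal) : IsBohrAP f := f.2

theorem tendsto_inner (f g : APReal) :
    Tendsto (fun T : ℝ => ((2 * T)⁻¹ : ℝ) • ∫ t in (-T)..T, (starRingEnd ℂ) (f t) * g t) atTop
      (𝓝 (apMean fun t => (starRingEnd ℂ) (f t) * g t)) :=
  (f.isBohrAP.star.mul g.isBohrAP).tendsto_mean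

theorem intervalIntegrable (f g : APReal) (a b : ℝ) :
    IntervalIntegrable (fun t => (starRingEnd ℂ) (f t) * g t) volume a b :=
  (f.isBohrAP.star.mul g.isBohrAP).1.intervalIntegrable a b

/-- The inner product of `AP(ℝ)`, conjugate linear in the first argument as everywhere in Mathlib,
so that `(f, g) = inner ℂ g f`. -/
@[reducible] def innerCore : PreInnerProductSpace.Core ℂ APReal where
  inner f g := apMean fun t => (starRingEnd ℂ) (f t) * g t
  conj_inner_symm f g := by
    have h := (Complex.continuous_conj.tendsto _).comp (tendsto_inner g f)
    refine tendsto_nhds_unique h ((tendsto_inner f g).congr fun T => ?_)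
    simp only [Function.comp_apply, Complex.real_smul, map_mul, Complex.conj_ofReal]
    rw [← intervalIntegral.intervalIntegral_conj]
    simp [mul_comm]
  re_inner_nonneg f := by
    have h := (Complex.continuous_re.tendsto _).comp (tendsto_inner f f)
    refine ge_of_tendsto h ?_
    filter_upwards [eventually_ge_atTop 0] with T hT
    have e : (fun t => (starRingEnd ℂ) (f t) * f t) = fun t => ((‖f t‖ ^ 2 : ℝ) : ℂ) := by
      funext t
      rw [mul_comm, Complex.mul_conj, Complex.normSq_eq_norm_sq]
    simp only [Function.comp_apply]
    rw [e, intervalIntegral.integral_ofReal, Complex.real_smul, ← Complex.ofReal_mul,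
      Complex.ofReal_re]
    exact mul_nonneg (by positivity)
      (intervalIntegral.integral_nonneg (by linarith) fun t _ => by positivity)
  add_left f g k := by
    refine tendsto_nhds_unique (tendsto_inner (f + g) k)
      (((tendsto_inner f k).add (tendsto_inner g k)).congr fun T => ?_)
    rw [← smul_add, ← intervalIntegral.integral_add (intervalIntegrable f k _ _)
      (intervalIntegrable g k _ _)]
    congr 2
    funext t
    rw [← add_mul, ← map_add]
    rfl
  smul_left f g c := by
    refine tendsto_nhds_unique (tendsto_inner (c • f) g)
      (((tendsto_inner f g).const_mul ((starRingEnd ℂ) c)).congr fun T => ?_)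
    rw [mul_smul_comm, ← intervalIntegral.integral_const_mul]
    congr 2
    funext t
    rw [← mul_assoc, ← map_mul]
    rfl

instance : SeminormedAddCommGroup APReal :=
  @InnerProductSpace.Core.toSeminormedAddCommGroup ℂ APReal _ _ _ innerCore

instance : InnerProductSpace ℂ APReal := InnerProductSpace.ofCore innerCore

end APReal

/-- The Hilbert space `AP₂(ℝ)` of Besicovitch almost periodic functions: the completion of `AP(ℝ)`
in the norm of its inner product. -/
abbrev AP2 : Type := UniformSpace.Completion APReal

/-! Almost periodic sequences -/

/-- Almost periodic two-sided sequences: for every `ε > 0` there is `N` such that any `N`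
consecutive integers contain an `ε`-almost period. -/
def IsAPSeq (a : ℤ → ℂ) : Prop :=
  ∀ ε : ℝ, 0 < ε → ∃ N : ℕ, ∀ m : ℤ, ∃ p ∈ Finset.Ico m (m + N), ∀ n : ℤ, ‖a (n + p) - a n‖ ≤ ε

/-- `r` is the norm of `a` in `AP(ℤ)`: `r ≥ 0` and
`r² = lim_{p → ∞} (2p)⁻¹ ∑_{n = -p}^{p} |a n|²`, where the limit is required to exist. -/
def HasAPSeqNorm (a : ℤ → ℂ) (r : ℝ) : Prop :=
  0 ≤ r ∧ Tendsto (fun p : ℕ => (2 * (p : ℝ))⁻¹ * ∑ n ∈ Finset.Icc (-(p : ℤ)) p, ‖a n‖ ^ 2) atTop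
    (𝓝 (r ^ 2))

/-! Fourier transform, the Wiener space, and the analysis map -/

/-- The Fourier transform `ψ̂(ω) = ∫ ψ(t) e^{-iωt} dt`. -/
def angularFourier (ψ : ℝ → ℂ) (ω : ℝ) : ℂ :=
  ∫ t : ℝ, ψ t * Complex.exp (-(Complex.I * ω * t))

/-- The Wiener norm `∑_{k ∈ ℤ} ess sup_{x ∈ [0,1]} |ψ(x - k)|`. -/
def wienerNorm (ψ : ℝ → ℂ) : ENNReal :=
  ∑' k : ℤ, eLpNormEssSup (fun x : ℝ => ψ (x - k)) (volume.restrict (Set.Icc 0 1))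

/-- The space `W₀`: continuous functions in the Wiener space (such functions are automatically
bounded). -/
def MemW0 (ψ : ℝ → ℂ) : Prop :=
  Continuous ψ ∧ wienerNorm ψ < ⊤

/-- The class of `ψ` modulo null sets belongs to `W₀`. -/
def ClassMemW0 (ψ : ℝ → ℂ) : Prop :=
  ∃ φ : ℝ → ℂ, MemW0 φ ∧ ψ =ᵐ[volume] φ

/-- The class of `ψ` modulo null sets is the Fourier transform of a function in `W₀`. -/
def ClassMemFourierW0 (ψ : ℝ → ℂ) : Prop :=
  ∃ φ : ℝ → ℂ, MemW0 φ ∧ ψ =ᵐ[volume] angularFourier φ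

/-- The sequence `k ↦ ⟨f, T_{kα} ψ⟩ = ∫ f(t) conj(ψ(t - kα)) dt`. -/
def translateCoeff (α : ℝ) (ψ f : ℝ → ℂ) (k : ℤ) : ℂ :=
  ∫ t : ℝ, f t * (starRingEnd ℂ) (ψ (t - k * α))

end

open MeasureTheory Filter Topology
noncomputable section

/-! Means of almost periodic functions -/

/-! The system is `h_λ = ∑_p ψ̂(λ + 2πp/α) e^{i(λ + 2πp/α)t}` (`AP2.fiberVector`). Characters are
orthonormal in `AP₂(ℝ)` and different `λ` use disjoint sets of frequencies, so the `h_λ` are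
orthogonal, and `‖h_λ‖²` is the sum that the hypothesis bounds uniformly in `λ`. A Bessel inequality
makes `T f = ((f, h_λ))_λ` a bounded operator into `ℓ²` (`orthogonalCoeff`). For a trigonometric
polynomial `∑ b_μ e^{iμt}` the coefficient sequence is `∑ b_μ conj(ψ̂(μ)) e^{iμαk}`; in its square
mean the product of the terms at `μ` and `ν` survives exactly when `μ ≡ ν` modulo `2π/α`, and what
survives adds up to `‖T P‖²`. Both sides are continuous in the sup norm, one because `ψ` is
integrable, the other because the sup norm dominates the norm of `AP₂(ℝ)`. So uniform density of
trigonometric polynomials gives the identity for all `f`. The sequence is almost periodic because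
`f` has relatively densely many almost periods in `αℤ`.

The uniform density is Bohr's approximation theorem, obtained by spectral theory. Suppose `w ≠ 0` is
orthogonal to every character. The operator `N g = (t ↦ (S_t g, w))`, with `S_t` translation, is
compact, nonzero, commutes with translations and kills all characters. A nonzero eigenvalue of `N*N`
has a finite-dimensional, translation-invariant eigenspace, which contains a joint eigenvector `u`
of all translations. Its eigenvalues form a continuous character `e^{il·}`, and `u` is orthogonal to
that character, hence zero: a contradiction. This gives density in `AP₂(ℝ)`; averaging translates
against a weight concentrated on almost periods of `f` upgrades it to uniform density.

For (b), if `ψ ∈ W₀` then Poisson summation identifies `h_λ` with a modulated periodization of `ψ`,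
which is continuous. If `ψ = φ̂` with `φ ∈ W₀`, Fourier inversion makes the series for `h_λ`
absolutely convergent. -/

theorem apMean_eq_of_tendsto {f : ℝ → ℂ} {c : ℂ}
    (h : Tendsto (fun T : ℝ => ((2 * T)⁻¹ : ℝ) • ∫ t in (-T)..T, f t) atTop (𝓝 c)) :
    apMean f = c :=
  h.limUnder_eq

theorem IsBohrAP.norm_apMean_le {f : ℝ → ℂ} (hf : IsBohrAP f) {C : ℝ} (hC : ∀ t, ‖f t‖ ≤ C) :
    ‖apMean f‖ ≤ C := by
  refine le_of_tendsto hf.tendsto_mean.norm ?_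
  filter_upwards [eventually_gt_atTop 0] with T hT
  have h1 : ‖∫ t in (-T)..T, f t‖ ≤ C * |T - -T| :=
    intervalIntegral.norm_integral_le_of_norm_le_const fun t _ => hC t
  rw [norm_smul, norm_inv, Real.norm_eq_abs, abs_of_pos (by positivity),
    inv_mul_le_iff₀ (by positivity)]
  rw [abs_of_pos (by linarith)] at h1
  linarith

theorem IsBohrAP.comp_add_right {f : ℝ → ℂ} (hf : IsBohrAP f) (x : ℝ) :
    IsBohrAP fun t => f (t + x) := by
  refine ⟨hf.1.comp (continuous_add_const x), fun ε hε => ?_⟩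
  obtain ⟨L, hL, h⟩ := hf.2 ε hε
  refine ⟨L, hL, fun a b hab => ?_⟩
  obtain ⟨τ, hτ, h1⟩ := h a b hab
  refine ⟨τ, hτ, fun t => ?_⟩
  change ‖f (t + τ + x) - f (t + x)‖ ≤ ε
  rw [add_right_comm]
  exact h1 _

/-- Shifting the window changes the integral only by two end pieces of length `|x|`, which stay
bounded while the window grows. -/
theorem IsBohrAP.apMean_comp_add_right {f : ℝ → ℂ} (hf : IsBohrAP f) (x : ℝ) :
    apMean (fun t => f (t + x)) = apMean f := by
  obtain ⟨M, hM, hMf⟩ := hf.bounded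
  have hi : ∀ a b : ℝ, IntervalIntegrable f volume a b := fun a b => hf.1.intervalIntegrable a b
  refine apMean_eq_of_tendsto ?_
  have hz : Tendsto (fun T : ℝ => (2 * T)⁻¹ * (2 * (M * |x|))) atTop (𝓝 0) := by
    have : Tendsto (fun T : ℝ => (2 * T)⁻¹) atTop (𝓝 0) :=
      tendsto_inv_atTop_zero.comp (tendsto_id.const_mul_atTop two_pos)
    simpa using this.mul_const (2 * (M * |x|))
  have hd : Tendsto (fun T : ℝ => ((2 * T)⁻¹ : ℝ) • (∫ t in (-T)..T, f (t + x))
      - ((2 * T)⁻¹ : ℝ) • ∫ t in (-T)..T, f t) atTop (𝓝 0) := by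
    refine squeeze_zero_norm' ?_ hz
    filter_upwards [eventually_gt_atTop 0] with T hT
    rw [← smul_sub, norm_smul, norm_inv, Real.norm_eq_abs, abs_of_pos (by positivity)]
    gcongr
    rw [intervalIntegral.integral_comp_add_right]
    have e : (∫ t in (-T + x)..(T + x), f t) - ∫ t in (-T)..T, f t
        = (∫ t in T..(T + x), f t) - ∫ t in (-T)..(-T + x), f t := by
      rw [intervalIntegral.integral_interval_sub_interval_comm' (hi _ _) (hi _ _) (hi _ _)]
    have b : ∀ s : ℝ, ‖∫ t in s..(s + x), f t‖ ≤ M * |x| := fun s => by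
      have := intervalIntegral.norm_integral_le_of_norm_le_const (a := s) (b := s + x)
        fun t _ => hMf t
      simpa using this
    rw [e]
    exact (norm_sub_le _ _).trans (by linarith [b T, b (-T)])
  simpa using hd.add hf.tendsto_mean

/-- The averages over long intervals converge to the mean uniformly in the position of the
interval. -/
theorem IsBohrAP.norm_average_sub_apMean_le {f : ℝ → ℂ} (hf : IsBohrAP f) {ε : ℝ} (hε : 0 < ε) :
    ∀ᶠ T : ℝ in atTop, ∀ s : ℝ, ‖(T⁻¹ : ℝ) • (∫ t in s..(s + T), f t) - apMean f‖ ≤ ε := by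
  -- Both the given and the centred interval are compared with `[0, T]`. Each comparison costs `εT/5
  -- + K`, and `K < εT/5` for large `T`; the last fifth is for the convergence of the centred
  -- averages.
  obtain ⟨K, hK, h⟩ := hf.integral_shift (ε / 5) (by linarith)
  have h1 : Tendsto (fun T : ℝ => T / 2) atTop atTop := tendsto_id.atTop_div_const two_pos
  have h2 := (Metric.tendsto_nhds.1 (hf.tendsto_mean.comp h1)) (ε / 5) (by linarith)
  filter_upwards [h2, eventually_gt_atTop 0, eventually_gt_atTop (5 * K / ε)] with T hT hT0 hTK s
  rw [dist_eq_norm] at hT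
  simp only [Function.comp_apply, mul_div_cancel₀ T (two_ne_zero' ℝ)] at hT
  have a1 := h s T hT0.le
  have a2 := h (-(T / 2)) T hT0.le
  rw [show -(T / 2) + T = T / 2 by ring] at a2
  rw [div_lt_iff₀ hε] at hTK
  have e : (T⁻¹ : ℝ) • (∫ t in s..(s + T), f t) - apMean f
      = (T⁻¹ : ℝ) • (((∫ t in s..(s + T), f t) - ∫ t in (0 : ℝ)..T, f t)
        - ((∫ t in (-(T / 2))..(T / 2), f t) - ∫ t in (0 : ℝ)..T, f t))
        + ((T⁻¹ : ℝ) • (∫ t in (-(T / 2))..(T / 2), f t) - apMean f) := by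
    simp only [smul_sub]; ring
  rw [e]
  refine (norm_add_le _ _).trans ?_
  have b : ‖(T⁻¹ : ℝ) • (((∫ t in s..(s + T), f t) - ∫ t in (0 : ℝ)..T, f t)
        - ((∫ t in (-(T / 2))..(T / 2), f t) - ∫ t in (0 : ℝ)..T, f t))‖ ≤ 4 * ε / 5 := by
    rw [norm_smul, norm_inv, Real.norm_eq_abs, abs_of_pos hT0, inv_mul_le_iff₀ hT0]
    refine (norm_sub_le _ _).trans ?_
    nlinarith
  linarith

/-- The mean is uniformly approximated by averages of finitely many translates. -/
theorem IsBohrAP.exists_average_translates {f : ℝ → ℂ} (hf : IsBohrAP f) {ε : ℝ} (hε : 0 < ε) :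
    ∃ (n : ℕ) (δ : ℝ), 0 < n ∧
      ∀ t : ℝ, ‖(n : ℂ)⁻¹ * ∑ i ∈ Finset.range n, f (t + i * δ) - apMean f‖ ≤ ε := by
  obtain ⟨δ, hδ, hu⟩ := hf.uniformContinuous (ε / 2) (by linarith)
  have hi : ∀ a b : ℝ, IntervalIntegrable f volume a b := fun a b => hf.1.intervalIntegrable a b
  -- The averages are Riemann sums of mesh `η`, kept strictly below `δ` so that uniform continuity
  -- applies on each closed cell.
  set η : ℝ := δ / 2 with hη
  have hη0 : 0 < η := by positivity
  have h1 : Tendsto (fun n : ℕ => (n : ℝ) * η) atTop atTop :=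
    tendsto_natCast_atTop_atTop.atTop_mul_const hη0
  obtain ⟨n, hn, hn0⟩ := ((h1.eventually (hf.norm_average_sub_apMean_le (half_pos hε))).and
    (eventually_gt_atTop 0)).exists
  refine ⟨n, η, hn0, fun t => ?_⟩
  have hn0' : (0 : ℝ) < n := by exact_mod_cast hn0
  have hnc : (n : ℂ) ≠ 0 := by exact_mod_cast hn0'.ne'
  have hηc : (η : ℂ) ≠ 0 := by exact_mod_cast hη0.ne'
  have e1 : ∫ s in t..(t + n * η), f s
      = ∑ i ∈ Finset.range n, ∫ s in (t + i * η)..(t + (i + 1 : ℕ) * η), f s := by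
    rw [intervalIntegral.sum_integral_adjacent_intervals (a := fun i : ℕ => t + i * η)
      fun k _ => hi _ _]
    simp
  have e2 : ∀ i : ℕ, ‖(∫ s in (t + i * η)..(t + (i + 1 : ℕ) * η), f s) - η * f (t + i * η)‖
      ≤ ε / 2 * η := fun i => by
    have e3 : (t + (i + 1 : ℕ) * η) - (t + i * η) = η := by push_cast; ring
    have e4 : (∫ s in (t + i * η)..(t + (i + 1 : ℕ) * η), f s) - η * f (t + i * η)
        = ∫ s in (t + i * η)..(t + (i + 1 : ℕ) * η), (f s - f (t + i * η)) := by
      rw [intervalIntegral.integral_sub (hi _ _) intervalIntegrable_const,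
        intervalIntegral.integral_const, e3, Complex.real_smul]
    rw [e4]
    refine (intervalIntegral.norm_integral_le_of_norm_le_const (C := ε / 2) ?_).trans ?_
    · intro s hs
      rw [Set.uIoc_of_le (by linarith)] at hs
      refine hu _ _ ?_
      rw [abs_of_pos (by linarith [hs.1])]
      linarith [hs.2]
    · rw [e3, abs_of_pos hη0]
  have e5 : ‖(∫ s in t..(t + n * η), f s) - η * ∑ i ∈ Finset.range n, f (t + i * η)‖
      ≤ n * (ε / 2 * η) := by
    rw [e1, Finset.mul_sum, ← Finset.sum_sub_distrib]
    refine (norm_sum_le_of_le _ fun i _ => e2 i).trans ?_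
    simp
  have e6 : (n : ℂ)⁻¹ * ∑ i ∈ Finset.range n, f (t + i * η) - apMean f
      = ((((n : ℝ) * η)⁻¹ : ℝ) • (∫ s in t..(t + n * η), f s) - apMean f)
        - (((n : ℝ) * η)⁻¹ : ℝ) • ((∫ s in t..(t + n * η), f s)
          - η * ∑ i ∈ Finset.range n, f (t + i * η)) := by
    generalize ∑ i ∈ Finset.range n, f (t + i * η) = z
    simp only [Complex.real_smul]
    push_cast
    field_simp
    ring
  rw [e6]
  refine (norm_sub_le _ _).trans ?_
  have e7 : ‖(((n : ℝ) * η)⁻¹ : ℝ) • ((∫ s in t..(t + n * η), f s)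
          - η * ∑ i ∈ Finset.range n, f (t + i * η))‖ ≤ ε / 2 := by
    rw [norm_smul, norm_inv, Real.norm_eq_abs, abs_of_pos (by positivity),
      inv_mul_le_iff₀ (by positivity)]
    linarith
  linarith [hn t]

/-! ### Uniform limits, periodic functions and exponentials -/

theorem isBohrAP_of_tendsto_uniformly {f : ℝ → ℂ}
    (h : ∀ ε : ℝ, 0 < ε → ∃ g : ℝ → ℂ, IsBohrAP g ∧ ∀ t, ‖f t - g t‖ ≤ ε) : IsBohrAP f := by
  refine ⟨?_, fun ε hε => ?_⟩
  · refine continuous_of_uniform_approx_of_continuous fun u hu => ?_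
    obtain ⟨ε, hε, hεu⟩ := Metric.mem_uniformity_dist.1 hu
    obtain ⟨g, hg, hfg⟩ := h (ε / 2) (by linarith)
    exact ⟨g, hg.1, fun t => hεu (by rw [dist_eq_norm]; linarith [hfg t])⟩
  · obtain ⟨g, hg, hfg⟩ := h (ε / 3) (by linarith)
    obtain ⟨L, hL, hp⟩ := hg.2 (ε / 3) (by linarith)
    refine ⟨L, hL, fun a b hab => ?_⟩
    obtain ⟨τ, hτ, h1⟩ := hp a b hab
    refine ⟨τ, hτ, fun t => ?_⟩
    have e : f (t + τ) - f t
        = (f (t + τ) - g (t + τ)) + (g (t + τ) - g t) - (f t - g t) := by ring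
    rw [e]
    refine (norm_sub_le _ _).trans ?_
    have := norm_add_le (f (t + τ) - g (t + τ)) (g (t + τ) - g t)
    linarith [hfg t, hfg (t + τ), h1 t]

theorem Function.Periodic.isBohrAP {f : ℝ → ℂ} {c : ℝ} (hf : Function.Periodic f c) (hc : 0 < c)
    (hcont : Continuous f) : IsBohrAP f := by
  refine ⟨hcont, fun ε hε => ⟨c, hc, fun a b hab => ?_⟩⟩
  refine ⟨(⌊a / c⌋ + 1 : ℤ) * c, ⟨?_, ?_⟩, fun t => ?_⟩
  · have := Int.lt_floor_add_one (a / c)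
    rw [div_lt_iff₀ hc] at this
    exact_mod_cast this
  · have := Int.floor_le (a / c)
    rw [le_div_iff₀ hc] at this
    push_cast
    linarith
  · rw [hf.int_mul]
    simpa using hε.le

theorem isBohrAP_exp (μ : ℝ) : IsBohrAP fun t : ℝ => Complex.exp (Complex.I * μ * t) := by
  rcases eq_or_ne μ 0 with rfl | hμ
  · simpa using isBohrAP_const 1
  · refine Function.Periodic.isBohrAP (c := 2 * Real.pi / |μ|) (fun t => ?_)
      (by have := abs_pos.2 hμ; have := Real.pi_pos; positivity) (by fun_prop)
    have hμc : (μ : ℂ) ≠ 0 := by exact_mod_cast hμ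
    rw [Complex.exp_eq_exp_iff_exists_int]
    rcases abs_cases μ with ⟨h, -⟩ | ⟨h, -⟩
    · refine ⟨1, ?_⟩
      rw [h]
      push_cast
      field_simp
    · refine ⟨-1, ?_⟩
      rw [h]
      push_cast
      field_simp

/-! Almost periodic functions as vectors -/

namespace APReal

@[ext]
theorem ext {f g : APReal} (h : ∀ t, f t = g t) : f = g :=
  Subtype.ext (funext h)

/-- The element of `AP(ℝ)` given by an almost periodic function. -/
def mk (f : ℝ → ℂ) (hf : IsBohrAP f) : APReal := ⟨f, hf⟩

@[simp] theorem mk_apply (f : ℝ → ℂ) (hf : IsBohrAP f) (t : ℝ) : mk f hf t = f t := rfl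

@[simp] theorem add_apply (f g : APReal) (t : ℝ) : (f + g) t = f t + g t := rfl

@[simp] theorem sub_apply (f g : APReal) (t : ℝ) : (f - g) t = f t - g t := rfl

@[simp] theorem smul_apply (c : ℂ) (f : APReal) (t : ℝ) : (c • f) t = c * f t := rfl

@[simp] theorem zero_apply (t : ℝ) : (0 : APReal) t = 0 := rfl

/-- Evaluation at a point as a linear functional. -/
def evalₗ (t : ℝ) : APReal →ₗ[ℂ] ℂ where
  toFun f := f t
  map_add' _ _ := rfl
  map_smul' _ _ := rfl

@[simp] theorem sum_apply {ι : Type*} (s : Finset ι) (f : ι → APReal) (t : ℝ) :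
    (∑ i ∈ s, f i) t = ∑ i ∈ s, f i t :=
  map_sum (evalₗ t) f s

theorem inner_eq (f g : APReal) : inner ℂ f g = apMean fun t => (starRingEnd ℂ) (f t) * g t := rfl

theorem norm_le_of_forall {f : APReal} {C : ℝ} (hC : ∀ t, ‖f t‖ ≤ C) : ‖f‖ ≤ C := by
  have hC0 : 0 ≤ C := (norm_nonneg _).trans (hC 0)
  have h1 : ‖inner ℂ f f‖ ≤ C * C := by
    rw [inner_eq]
    refine (f.isBohrAP.star.mul f.isBohrAP).norm_apMean_le fun t => ?_
    simp only [Pi.mul_apply, norm_mul, RCLike.norm_conj]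
    exact mul_le_mul (hC t) (hC t) (norm_nonneg _) hC0
  rw [inner_self_eq_norm_sq_to_K, norm_pow, RCLike.norm_ofReal, abs_norm] at h1
  nlinarith [norm_nonneg f]

end APReal

/-! ### Linearity, positivity and invariance of the mean -/

theorem IsBohrAP.apMean_add {f g : ℝ → ℂ} (hf : IsBohrAP f) (hg : IsBohrAP g) :
    apMean (fun t => f t + g t) = apMean f + apMean g := by
  refine apMean_eq_of_tendsto ((hf.tendsto_mean.add hg.tendsto_mean).congr fun T => ?_)
  rw [← smul_add, ← intervalIntegral.integral_add (hf.1.intervalIntegrable _ _)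
    (hg.1.intervalIntegrable _ _)]

theorem IsBohrAP.apMean_const_mul {f : ℝ → ℂ} (hf : IsBohrAP f) (c : ℂ) :
    apMean (fun t => c * f t) = c * apMean f := by
  refine apMean_eq_of_tendsto ((hf.tendsto_mean.const_mul c).congr fun T => ?_)
  rw [intervalIntegral.integral_const_mul, mul_smul_comm]

theorem apMean_const (c : ℂ) : apMean (fun _ => c) = c := by
  refine apMean_eq_of_tendsto (tendsto_const_nhds.congr' ?_)
  filter_upwards [eventually_gt_atTop 0] with T hT
  have hTc : (T : ℂ) ≠ 0 := by exact_mod_cast hT.ne'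
  rw [intervalIntegral.integral_const, Complex.real_smul, Complex.real_smul]
  push_cast
  field_simp
  ring

theorem IsBohrAP.sum {ι : Type*} (s : Finset ι) {f : ι → ℝ → ℂ} (hf : ∀ i, IsBohrAP (f i)) :
    IsBohrAP fun t => ∑ i ∈ s, f i t := by
  classical
  induction s using Finset.induction_on with
  | empty => simpa using isBohrAP_const 0
  | insert a s ha ih =>
    simp only [Finset.sum_insert ha]
    exact (hf a).add ih

theorem IsBohrAP.apMean_sum {ι : Type*} (s : Finset ι) {f : ι → ℝ → ℂ}
    (hf : ∀ i, IsBohrAP (f i)) : apMean (fun t => ∑ i ∈ s, f i t) = ∑ i ∈ s, apMean (f i) := by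
  classical
  induction s using Finset.induction_on with
  | empty => simpa using apMean_const 0
  | insert a s ha ih =>
    simp only [Finset.sum_insert ha]
    rw [IsBohrAP.apMean_add (hf a) (IsBohrAP.sum s hf), ih]

theorem IsBohrAP.le_re_apMean {f : ℝ → ℂ} (hf : IsBohrAP f) {c : ℝ} (hc : ∀ t, c ≤ (f t).re) :
    c ≤ (apMean f).re := by
  refine ge_of_tendsto ((Complex.continuous_re.tendsto _).comp hf.tendsto_mean) ?_
  filter_upwards [eventually_gt_atTop 0] with T hT
  have h1 : ∫ _ in (-T)..T, c ≤ ∫ t in (-T)..T, (f t).re :=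
    intervalIntegral.integral_mono_on (by linarith) intervalIntegrable_const
      ((Complex.continuous_re.comp hf.1).intervalIntegrable _ _) fun t _ => hc t
  have h2 : (∫ t in (-T)..T, f t).re = ∫ t in (-T)..T, (f t).re :=
    (intervalIntegral.intervalIntegral_re (hf.1.intervalIntegrable _ _)).symm
  simp only [Function.comp_apply]
  rw [Complex.smul_re, h2, smul_eq_mul, le_inv_mul_iff₀ (by positivity)]
  rw [intervalIntegral.integral_const, smul_eq_mul] at h1
  linarith

/-- A nonnegative almost periodic function that does not vanish identically has positive mean. -/
theorem IsBohrAP.re_apMean_pos {f : ℝ → ℂ} (hf : IsBohrAP f) (h0 : ∀ t, 0 ≤ (f t).re) {t₀ : ℝ}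
    (ht₀ : 0 < (f t₀).re) : 0 < (apMean f).re := by
  obtain ⟨F, hF, h⟩ := hf.finite_translates ((f t₀).re / 2) (by linarith)
  have hS : ∀ r, IsBohrAP fun s => f (s + (t₀ + r)) := fun r => hf.comp_add_right _
  -- At each `s` one of the finitely many translates nearly reproduces the value `f t₀`, so their
  -- sum is bounded below everywhere. All translates have the same mean, which is therefore
  -- positive.
  have h1 : (f t₀).re / 2 ≤ (apMean fun s => ∑ r ∈ hF.toFinset, f (s + (t₀ + r))).re := by
    refine (IsBohrAP.sum _ hS).le_re_apMean fun s => ?_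
    obtain ⟨r, hr, hp⟩ := h (-s)
    have h2 := hp (t₀ + s)
    rw [show t₀ + s + -s = t₀ by ring] at h2
    have h3 := (Complex.abs_re_le_norm _).trans h2
    rw [Complex.sub_re] at h3
    have h4 := (abs_le.1 h3).2
    rw [Complex.re_sum]
    have h5 := Finset.single_le_sum (f := fun r => (f (s + (t₀ + r))).re) (fun i _ => h0 _)
      (hF.mem_toFinset.2 hr)
    rw [show t₀ + s + r = s + (t₀ + r) by ring] at h4
    linarith
  rw [IsBohrAP.apMean_sum _ hS] at h1
  simp only [hf.apMean_comp_add_right, Finset.sum_const, nsmul_eq_mul, Complex.mul_re,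
    Complex.natCast_re, Complex.natCast_im, zero_mul, sub_zero] at h1
  by_contra hneg
  have := mul_nonpos_of_nonneg_of_nonpos (Nat.cast_nonneg (α := ℝ) hF.toFinset.card)
    (not_lt.1 hneg)
  linarith

/-- Translation invariance forces the mean to equal `ζ` times itself. -/
theorem IsBohrAP.apMean_eq_zero_of_quasiperiodic {f : ℝ → ℂ} (hf : IsBohrAP f) {x : ℝ} {ζ : ℂ}
    (hζ : ζ ≠ 1) (h : ∀ t, f (t + x) = ζ * f t) : apMean f = 0 := by
  have h1 := hf.apMean_comp_add_right x
  simp only [h] at h1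
  rw [hf.apMean_const_mul] at h1
  have h2 : (ζ - 1) * apMean f = 0 := by rw [sub_mul, h1]; ring
  exact (mul_eq_zero.1 h2).resolve_left (sub_ne_zero.2 hζ)

/-- A function whose variation is controlled by the translates of an almost periodic function is
almost periodic. -/
theorem IsBohrAP.of_translates {f c : ℝ → ℂ} (hf : IsBohrAP f) {C : ℝ}
    (h : ∀ x y η : ℝ, (∀ t, ‖f (t + x) - f (t + y)‖ ≤ η) → ‖c x - c y‖ ≤ C * η) :
    IsBohrAP c := by
  have h' : ∀ x y ε : ℝ, 0 < ε → (∀ t, ‖f (t + x) - f (t + y)‖ ≤ ε / (|C| + 1)) →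
      ‖c x - c y‖ ≤ ε := fun x y ε hε hxy => by
    refine (h x y _ hxy).trans ?_
    rw [mul_div_assoc', div_le_iff₀ (by positivity)]
    nlinarith [le_abs_self C]
  refine ⟨Metric.continuous_iff.2 fun x ε hε => ?_, fun ε hε => ?_⟩
  · obtain ⟨δ, hδ, hu⟩ := hf.uniformContinuous (ε / 2 / (|C| + 1)) (by positivity)
    refine ⟨δ, hδ, fun y hy => ?_⟩
    rw [dist_eq_norm]
    refine (h' y x (ε / 2) (by linarith) fun t => hu _ _ ?_).trans_lt (by linarith)
    rw [Real.dist_eq] at hy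
    simpa using hy
  · obtain ⟨L, hL, hp⟩ := hf.2 (ε / (|C| + 1)) (by positivity)
    refine ⟨L, hL, fun a b hab => ?_⟩
    obtain ⟨τ, hτ, h1⟩ := hp a b hab
    refine ⟨τ, hτ, fun t => h' _ _ ε hε fun s => ?_⟩
    rw [← add_assoc]
    exact h1 _

namespace APReal

/-- The mean of `|f|²` is positive unless `f` vanishes identically, so the seminorm is in fact a
norm. This is what makes the operator `N` of the spectral argument nonzero. -/
theorem eq_zero_of_norm_eq_zero {f : APReal} (hf : ‖f‖ = 0) (t : ℝ) : f t = 0 := by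
  by_contra hne
  have e : ∀ s, (starRingEnd ℂ) (f s) * f s = ((‖f s‖ ^ 2 : ℝ) : ℂ) := fun s => by
    rw [mul_comm, Complex.mul_conj, Complex.normSq_eq_norm_sq]
  have h1 : 0 < (inner ℂ f f : ℂ).re := by
    rw [inner_eq]
    refine (f.isBohrAP.star.mul f.isBohrAP).re_apMean_pos (t₀ := t) (fun s => ?_) ?_
    · simp only [Pi.mul_apply, e, Complex.ofReal_re]
      positivity
    · simp only [Pi.mul_apply, e, Complex.ofReal_re]
      have := norm_pos_iff.2 hne
      positivity
  rw [inner_self_eq_norm_sq_to_K, hf] at h1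
  simp at h1

/-- Translation of almost periodic functions. -/
def translateₗ (x : ℝ) : APReal →ₗ[ℂ] APReal where
  toFun f := mk (fun t => f (t + x)) (f.isBohrAP.comp_add_right x)
  map_add' _ _ := rfl
  map_smul' _ _ := rfl

theorem norm_translateₗ (x : ℝ) (f : APReal) : ‖translateₗ x f‖ = ‖f‖ := by
  have h : (inner ℂ (translateₗ x f) (translateₗ x f) : ℂ) = inner ℂ f f :=
    (f.isBohrAP.star.mul f.isBohrAP).apMean_comp_add_right x
  rw [inner_self_eq_norm_sq_to_K, inner_self_eq_norm_sq_to_K] at h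
  have h2 : ‖translateₗ x f‖ ^ 2 = ‖f‖ ^ 2 := by exact_mod_cast h
  exact (pow_left_inj₀ (norm_nonneg _) (norm_nonneg _) two_ne_zero).1 h2

/-- Translation of almost periodic functions as a continuous linear map. -/
def translate (x : ℝ) : APReal →L[ℂ] APReal :=
  (translateₗ x).mkContinuous 1 fun f => by rw [norm_translateₗ, one_mul]

@[simp] theorem translate_apply (x : ℝ) (f : APReal) (t : ℝ) : translate x f t = f (t + x) := rfl

/-- The character `t ↦ exp(iμt)`. -/
def char (μ : ℝ) : APReal := mk (fun t => Complex.exp (Complex.I * μ * t)) (isBohrAP_exp μ)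

@[simp] theorem char_apply (μ t : ℝ) : char μ t = Complex.exp (Complex.I * μ * t) := rfl

theorem inner_char (μ : ℝ) (f : APReal) :
    inner ℂ (char μ) f = apMean fun t => Complex.exp (-(Complex.I * μ * t)) * f t := by
  rw [inner_eq]
  congr 1
  funext t
  rw [char_apply, ← Complex.exp_conj]
  simp

theorem inner_char_char (μ ν : ℝ) :
    inner ℂ (char μ) (char ν) = if μ = ν then (1 : ℂ) else 0 := by
  rw [inner_char]
  split_ifs with h
  · subst h
    simp only [char_apply, ← Complex.exp_add, neg_add_cancel, Complex.exp_zero]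
    exact apMean_const 1
  · have e : (fun t : ℝ => Complex.exp (-(Complex.I * μ * t)) * char ν t)
        = fun t : ℝ => Complex.exp (Complex.I * (ν - μ : ℝ) * t) := by
      funext t
      rw [char_apply, ← Complex.exp_add]
      congr 1
      push_cast
      ring
    rw [e]
    have h1 : (((ν - μ : ℝ)) : ℂ) ≠ 0 := by exact_mod_cast sub_ne_zero.2 (Ne.symm h)
    -- A shift by half a period changes the sign.
    refine (isBohrAP_exp (ν - μ)).apMean_eq_zero_of_quasiperiodic (x := Real.pi / (ν - μ)) (ζ := -1)
      (by norm_num) fun t => ?_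
    rw [← Complex.exp_pi_mul_I, ← Complex.exp_add]
    congr 1
    push_cast at h1 ⊢
    field_simp
    ring

end APReal

/-! ### Translations on `AP₂(ℝ)` and the compact orbit operators -/

namespace AP2

open APReal

/-- Translation on `AP₂(ℝ)`. -/
def shift (x : ℝ) : AP2 →L[ℂ] AP2 := (APReal.translate x).completion

@[simp] theorem shift_coe (x : ℝ) (f : APReal) : shift x (f : AP2) = (APReal.translate x f : APReal) :=
  ContinuousLinearMap.completion_apply_coe _ _

theorem shift_shift (x y : ℝ) (g : AP2) : shift x (shift y g) = shift (x + y) g := by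
  induction g using UniformSpace.Completion.induction_on with
  | hp => exact isClosed_eq (by fun_prop) (by fun_prop)
  | ih f =>
    rw [shift_coe, shift_coe, shift_coe]
    congr 1
    ext t
    simp [add_assoc]

theorem shift_zero (g : AP2) : shift 0 g = g := by
  induction g using UniformSpace.Completion.induction_on with
  | hp => exact isClosed_eq (by fun_prop) (by fun_prop)
  | ih f =>
    rw [shift_coe]
    congr 1
    ext t
    simp

theorem norm_shift (x : ℝ) (g : AP2) : ‖shift x g‖ = ‖g‖ := by
  induction g using UniformSpace.Completion.induction_on with
  | hp => exact isClosed_eq (by fun_prop) (by fun_prop)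
  | ih f =>
    rw [shift_coe, UniformSpace.Completion.norm_coe, UniformSpace.Completion.norm_coe]
    exact norm_translateₗ x f

/-- Translation as a linear isometry. -/
def shiftₗᵢ (x : ℝ) : AP2 →ₗᵢ[ℂ] AP2 := ⟨shift x, norm_shift x⟩

theorem inner_shift_shift (x : ℝ) (u v : AP2) : inner ℂ (shift x u) (shift x v) = inner ℂ u v :=
  (shiftₗᵢ x).inner_map_map u v

theorem inner_shift_neg (x : ℝ) (u v : AP2) : inner ℂ (shift (-x) u) v = inner ℂ u (shift x v) := by
  rw [← inner_shift_shift x, shift_shift, add_neg_cancel, shift_zero]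

theorem shift_char (x μ : ℝ) :
    shift x (char μ : AP2) = Complex.exp (Complex.I * μ * x) • (char μ : AP2) := by
  rw [shift_coe, ← UniformSpace.Completion.coe_smul]
  congr 1
  ext t
  rw [smul_apply, translate_apply, char_apply, char_apply, ← Complex.exp_add]
  congr 1
  push_cast
  ring

theorem exists_coe_near (g : AP2) {ε : ℝ} (hε : 0 < ε) : ∃ f : APReal, ‖g - f‖ < ε := by
  obtain ⟨f, hf⟩ := UniformSpace.Completion.denseRange_coe.exists_dist_lt g hε
  exact ⟨f, by rwa [← dist_eq_norm]⟩

theorem norm_coe_le {f : APReal} {C : ℝ} (hC : ∀ t, ‖f t‖ ≤ C) : ‖(f : AP2)‖ ≤ C := by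
  rw [UniformSpace.Completion.norm_coe]
  exact norm_le_of_forall hC

/-- For `g` in `AP(ℝ)` the variation is controlled by the translates of `g`; the general case is a
uniform limit, since translations are isometries. -/
theorem isBohrAP_inner_shift (w g : AP2) : IsBohrAP fun t => inner ℂ w (shift t g) := by
  refine isBohrAP_of_tendsto_uniformly fun ε hε => ?_
  obtain ⟨f, hf⟩ := exists_coe_near g (ε := ε / (‖w‖ + 1)) (by positivity)
  refine ⟨fun t => inner ℂ w (shift t (f : AP2)), ?_, fun t => ?_⟩
  · refine f.isBohrAP.of_translates (C := ‖w‖) fun x y η h => ?_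
    rw [← inner_sub_right]
    refine (norm_inner_le_norm _ _).trans ?_
    gcongr
    rw [shift_coe, shift_coe, ← UniformSpace.Completion.coe_sub]
    exact norm_coe_le h
  · rw [← inner_sub_right, ← map_sub]
    refine (norm_inner_le_norm _ _).trans ?_
    rw [norm_shift]
    rw [lt_div_iff₀ (by positivity)] at hf
    nlinarith [norm_nonneg (g - f)]

/-- Orbits of translation are totally bounded. -/
theorem finite_shifts (w : AP2) {ε : ℝ} (hε : 0 < ε) :
    ∃ F : Set ℝ, F.Finite ∧ ∀ s : ℝ, ∃ r ∈ F, ‖shift s w - shift r w‖ ≤ ε := by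
  obtain ⟨f, hf⟩ := exists_coe_near w (ε := ε / 3) (by positivity)
  obtain ⟨F, hF, h⟩ := f.isBohrAP.finite_translates (ε / 3) (by positivity)
  refine ⟨F, hF, fun s => ?_⟩
  obtain ⟨r, hr, hp⟩ := h s
  refine ⟨r, hr, ?_⟩
  have e : shift s w - shift r w = (shift s (w - f) - shift r (w - f))
      + (shift s (f : AP2) - shift r (f : AP2)) := by
    rw [map_sub, map_sub]; abel
  have h1 : ‖shift s (f : AP2) - shift r (f : AP2)‖ ≤ ε / 3 := by
    rw [shift_coe, shift_coe, ← UniformSpace.Completion.coe_sub]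
    exact norm_coe_le hp
  rw [e]
  refine (norm_add_le _ _).trans ?_
  have h2 := norm_sub_le (shift s (w - f)) (shift r (w - f))
  rw [norm_shift, norm_shift] at h2
  linarith

/-- The map `g ↦ (t ↦ (w, S_t g))`, with values in the almost periodic functions. -/
def orbitₗ (w : AP2) : AP2 →ₗ[ℂ] APReal where
  toFun g := mk (fun t => inner ℂ w (shift t g)) (isBohrAP_inner_shift w g)
  map_add' g h := by ext t; simp [inner_add_right]
  map_smul' c g := by ext t; simp [inner_smul_right]

@[simp] theorem orbitₗ_apply (w g : AP2) (t : ℝ) : orbitₗ w g t = inner ℂ w (shift t g) := rfl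

theorem norm_orbitₗ_apply_le (w g : AP2) (t : ℝ) : ‖orbitₗ w g t‖ ≤ ‖w‖ * ‖g‖ := by
  rw [orbitₗ_apply]
  refine (norm_inner_le_norm _ _).trans ?_
  rw [norm_shift]

/-- The map `g ↦ (t ↦ (w, S_t g))` as a continuous linear operator on `AP₂(ℝ)`. -/
def orbit (w : AP2) : AP2 →L[ℂ] AP2 :=
  UniformSpace.Completion.toComplL.comp ((orbitₗ w).mkContinuous ‖w‖ fun g =>
    norm_le_of_forall (norm_orbitₗ_apply_le w g))

theorem orbit_apply (w g : AP2) : orbit w g = (orbitₗ w g : APReal) := rfl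

theorem orbit_shift (w g : AP2) (x : ℝ) : orbit w (shift x g) = shift x (orbit w g) := by
  rw [orbit_apply, orbit_apply, shift_coe]
  congr 1
  ext t
  rw [translate_apply, orbitₗ_apply, orbitₗ_apply, shift_shift]

/-- An Arzelà–Ascoli argument: since `(w, S_t g) = (S_{-t} w, g)` and the orbit of `w` is totally
bounded, the values at all `t` are determined up to a small error, uniformly on the unit ball, by
pairings with finitely many translates of `w`. Those pairings range over a bounded set in a
finite-dimensional space. -/
theorem isCompactOperator_orbit (w : AP2) : IsCompactOperator (orbit w) := by
  refine (isCompactOperator_iff_isCompact_closure_image_closedBall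
    (orbit w : AP2 →ₗ[ℂ] AP2) one_pos).2 ?_
  refine TotallyBounded.isCompact_of_isClosed (TotallyBounded.closure ?_) isClosed_closure
  refine Metric.totallyBounded_of_finite_discretization fun ε hε => ?_
  obtain ⟨F, hF, hnet⟩ := finite_shifts w (ε := ε / 8) (by positivity)
  have : Fintype F := hF.fintype
  let Λ : AP2 →L[ℂ] (F → ℂ) := ContinuousLinearMap.pi fun r => innerSL ℂ (shift r w)
  have hΛ : TotallyBounded (Λ '' Metric.closedBall 0 1) :=
    (Λ.lipschitz.isBounded_image Metric.isBounded_closedBall).isCompact_closure.totallyBounded.subset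
      subset_closure
  obtain ⟨s, hs, hcov⟩ := Metric.totallyBounded_iff.1 hΛ (ε / 8) (by positivity)
  have : Fintype s := hs.fintype
  have hex : ∀ y : (orbit w : AP2 →ₗ[ℂ] AP2) '' Metric.closedBall 0 1, ∃ (g : AP2) (z : s),
      ‖g‖ ≤ 1 ∧ orbit w g = y ∧ ‖Λ g - z‖ < ε / 8 := by
    rintro ⟨_, g, hg, rfl⟩
    obtain ⟨z, hz, hb⟩ := Set.mem_iUnion₂.1 (hcov ⟨g, hg, rfl⟩)
    exact ⟨g, ⟨z, hz⟩, by simpa using hg, rfl, by rwa [← dist_eq_norm]⟩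
  choose g z hg hy hz using hex
  -- Points of the image are classified by the net point next to the finite vector of pairings of a
  -- chosen preimage; images in one class are uniformly `ε/2`-close.
  refine ⟨s, inferInstance, z, fun x y hxy => ?_⟩
  change dist (x : AP2) (y : AP2) < ε
  rw [dist_eq_norm, ← hy x, ← hy y, ← map_sub, orbit_apply]
  have hg2 : ‖g x - g y‖ ≤ 2 := (norm_sub_le _ _).trans (by linarith [hg x, hg y])
  refine (norm_coe_le (C := ε / 2) fun t => ?_).trans_lt (by linarith)
  obtain ⟨r, hr, hb⟩ := hnet (-t)
  have e : orbitₗ w (g x - g y) t = Λ (g x - g y) ⟨r, hr⟩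
      + inner ℂ (shift (-t) w - shift r w) (g x - g y) := by
    rw [orbitₗ_apply, ← inner_shift_neg, inner_sub_left]
    simp [Λ]
  have h1 : ‖Λ (g x - g y) ⟨r, hr⟩‖ ≤ ε / 4 := by
    refine (norm_le_pi_norm _ _).trans ?_
    have e2 : Λ (g x - g y) = (Λ (g x) - z x) - (Λ (g y) - z y) := by
      rw [map_sub, hxy]; abel
    rw [e2]
    refine (norm_sub_le _ _).trans ?_
    linarith [hz x, hz y]
  have h2 : ‖inner ℂ (shift (-t) w - shift r w) (g x - g y)‖ ≤ ε / 8 * 2 :=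
    (norm_inner_le_norm _ _).trans (by gcongr)
  rw [e]
  exact (norm_add_le _ _).trans (by linarith)

end AP2

/-! ### Characters of `ℝ` and joint eigenvectors -/

/-- Continuous unitary characters of `ℝ` are exponentials. -/
theorem exists_eq_exp_of_continuous_character {χ : ℝ → ℂ} (hc : Continuous χ)
    (hmul : ∀ x y, χ (x + y) = χ x * χ y) (hn : ∀ x, ‖χ x‖ = 1) :
    ∃ l : ℝ, ∀ x, χ x = Complex.exp (Complex.I * l * x) := by
  have hne : ∀ x, χ x ≠ 0 := fun x h => by simpa [h] using hn x
  have h0 : χ 0 = 1 := by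
    have := hmul 0 0
    rw [add_zero] at this
    exact (mul_eq_left₀ (hne 0)).1 this.symm
  have hi : ∀ a b : ℝ, IntervalIntegrable χ volume a b := fun a b => hc.intervalIntegrable a b
  have hF : ∀ x, HasDerivAt (fun x => ∫ t in (0 : ℝ)..x, χ t) (χ x) x := fun x =>
    intervalIntegral.integral_hasDerivAt_right (hi _ _)
      hc.stronglyMeasurable.stronglyMeasurableAtFilter hc.continuousAt
  obtain ⟨a, ha⟩ : ∃ a, ∫ t in (0 : ℝ)..a, χ t ≠ 0 := by
    by_contra! hall
    have h1 := hF 0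
    simp only [hall] at h1
    exact one_ne_zero (h0 ▸ h1.unique (hasDerivAt_const 0 0))
  set c := ∫ t in (0 : ℝ)..a, χ t with hcdef
  set β : ℂ := (χ a - 1) / c with hβ
  -- Integrating `χ (x + t) = χ x * χ t` over `[0, a]` writes `χ` through its own primitive. So `χ`
  -- is differentiable and satisfies `χ' = β χ`.
  have hχ : ∀ x, χ x = ((∫ t in (0 : ℝ)..(x + a), χ t) - ∫ t in (0 : ℝ)..x, χ t) / c := fun x => by
    rw [eq_div_iff ha, intervalIntegral.integral_interval_sub_left (hi _ _) (hi _ _), hcdef,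
      ← intervalIntegral.integral_const_mul]
    simp only [← hmul]
    rw [intervalIntegral.integral_comp_add_left, add_zero]
  have hd : ∀ x, HasDerivAt χ (β * χ x) x := fun x => by
    have h1 := (((hF (x + a)).comp_add_const x a).sub (hF x)).div_const c
    have h2 : (χ (x + a) - χ x) / c = β * χ x := by rw [hmul, hβ]; ring
    rw [h2] at h1
    exact h1.congr_of_eventuallyEq (Eventually.of_forall fun y => hχ y)
  have he : ∀ x : ℝ, HasDerivAt (fun x : ℝ => Complex.exp (-(β * x)))
      (Complex.exp (-(β * x)) * -β) x := fun x => by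
    have h1 : HasDerivAt (fun x : ℝ => -(β * x)) (-β) x := by
      simpa using ((Complex.ofRealCLM.hasDerivAt (x := x)).const_mul β).fun_neg
    exact h1.cexp
  have hexp : ∀ x : ℝ, χ x = Complex.exp (β * x) := fun x => by
    have h1 := is_const_of_deriv_eq_zero (f := fun x : ℝ => χ x * Complex.exp (-(β * x)))
      (fun x => ((hd x).mul (he x)).differentiableAt)
      (fun x => by
        have := ((hd x).mul (he x)).deriv
        exact this.trans (by ring)) x 0
    simp only [h0, Complex.ofReal_zero, mul_zero, neg_zero, Complex.exp_zero, mul_one] at h1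
    rw [Complex.exp_neg] at h1
    rwa [← div_eq_mul_inv, div_eq_one_iff_eq (Complex.exp_ne_zero _)] at h1
  have hre : β.re = 0 := by
    have h1 := hn 1
    rw [hexp, Complex.norm_exp] at h1
    simpa using h1
  refine ⟨β.im, fun x => ?_⟩
  rw [hexp]
  congr 2
  apply Complex.ext <;> simp [hre]

/-- Commuting operators have a joint eigenvector in every nonzero finite-dimensional invariant
subspace. -/
theorem Submodule.exists_joint_eigenvector {K V ι : Type*} [Field K] [IsAlgClosed K]
    [AddCommGroup V] [Module K V] (T : ι → V →ₗ[K] V) (hT : ∀ i j v, T i (T j v) = T j (T i v))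
    (E : Submodule K V) [FiniteDimensional K E] (hE : E ≠ ⊥) (hinv : ∀ i, ∀ v ∈ E, T i v ∈ E) :
    ∃ v ∈ E, v ≠ 0 ∧ ∀ i, ∃ c : K, T i v = c • v := by
  induction h : Module.finrank K E using Nat.strong_induction_on generalizing E with
  | _ n ih =>
  -- If all operators are scalar on `E`, any nonzero vector works. Otherwise an eigenspace in `E` of
  -- a non-scalar one is a smaller nonzero subspace, invariant by commutation.
  by_cases hs : ∀ i, ∃ c : K, ∀ v ∈ E, T i v = c • v
  · obtain ⟨v, hv, hv0⟩ := E.ne_bot_iff.1 hE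
    exact ⟨v, hv, hv0, fun i => (hs i).imp fun c hc => hc v hv⟩
  · push Not at hs
    obtain ⟨i, hi⟩ := hs
    have : Nontrivial E := Submodule.nontrivial_iff_ne_bot.2 hE
    obtain ⟨c, hc⟩ := Module.End.exists_eigenvalue ((T i).restrict (hinv i))
    obtain ⟨v, hv⟩ := hc.exists_hasEigenvector
    obtain ⟨w, hw, hwc⟩ := hi c
    let E' : Submodule K V := E ⊓ Module.End.eigenspace (T i) c
    have hlt : E' < E := by
      refine lt_of_le_of_ne inf_le_left fun heq => hwc ?_
      have : w ∈ E' := heq ▸ hw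
      exact Module.End.mem_eigenspace_iff.1 this.2
    have hfin : FiniteDimensional K E' := Submodule.finiteDimensional_of_le hlt.le
    obtain ⟨u, hu, hu0, huT⟩ := ih _ (h ▸ Submodule.finrank_lt_finrank_of_lt hlt) E'
      ((Submodule.ne_bot_iff _).2 ⟨v, ⟨v.2, Module.End.mem_eigenspace_iff.2 (by
        simpa using congrArg Subtype.val hv.apply_eq_smul)⟩, by simpa using hv.2⟩)
      (fun j v hv => ⟨hinv j v hv.1, Module.End.mem_eigenspace_iff.2 (by
        rw [hT, Module.End.mem_eigenspace_iff.1 hv.2, map_smul])⟩) rfl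
    exact ⟨u, hu.1, hu0, huT⟩

/-! ### Completeness of the characters -/

namespace AP2

open APReal

/-- A vector on which translations act through the character `exp(iλ·)` is a multiple of that
character. -/
theorem eq_zero_of_shift_eq_exp_smul {u : AP2} {l : ℝ}
    (hu : ∀ x, shift x u = Complex.exp (Complex.I * l * x) • u)
    (h0 : inner ℂ (char l : AP2) u = 0) : u = 0 := by
  suffices h : ∀ f : APReal, inner ℂ (f : AP2) u = 0 by
    refine ext_inner_left ℂ fun v => ?_
    rw [inner_zero_right]
    induction v using UniformSpace.Completion.induction_on with
    | hp => exact isClosed_eq (by fun_prop) (by fun_prop)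
    | ih f => exact h f
  intro f
  have hg := f.isBohrAP.mul (isBohrAP_exp (-l))
  set g : ℝ → ℂ := f * fun t : ℝ => Complex.exp (Complex.I * (-l : ℝ) * t) with hgdef
  have key : ∀ ε : ℝ, 0 < ε → ‖inner ℂ (f : AP2) u‖ ≤ ε * ‖u‖ := fun ε hε => by
    obtain ⟨n, δ, hn, hp⟩ := hg.exists_average_translates hε
    have hnc : (n : ℂ) ≠ 0 := by exact_mod_cast hn.ne'
    -- Average of translates of `f`, modulated so that each has the same pairing with `u` as `f`
    -- has. By the choice of `n` and `δ`, `F` is uniformly close to a multiple of `char l`, which is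
    -- orthogonal to `u`.
    let F : APReal := (n : ℂ)⁻¹ • ∑ i ∈ Finset.range n,
      Complex.exp (Complex.I * (-l : ℝ) * (i * δ : ℝ)) • APReal.translate (i * δ) f
    have e1 : inner ℂ (F : AP2) u = inner ℂ (f : AP2) u := by
      have e2 : ∀ i : ℕ, inner ℂ ((Complex.exp (Complex.I * (-l : ℝ) * (i * δ : ℝ)) •
          APReal.translate (i * δ) f : APReal) : AP2) u = inner ℂ (f : AP2) u := fun i => by
        rw [UniformSpace.Completion.coe_smul, inner_smul_left, ← shift_coe,
          show (i * δ : ℝ) = -(-(i * δ)) by ring, inner_shift_neg, hu, inner_smul_right,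
          ← mul_assoc, ← Complex.exp_conj, ← Complex.exp_add]
        simp
      have e3 : (F : AP2) = (n : ℂ)⁻¹ • ∑ i ∈ Finset.range n,
          ((Complex.exp (Complex.I * (-l : ℝ) * (i * δ : ℝ)) •
            APReal.translate (i * δ) f : APReal) : AP2) := by
        rw [UniformSpace.Completion.coe_smul]
        congr 1
        exact map_sum (UniformSpace.Completion.toComplL (𝕜 := ℂ) (E := APReal)) _ _
      rw [e3, inner_smul_left, sum_inner]
      simp only [e2, Finset.sum_const, Finset.card_range, nsmul_eq_mul]
      simp [hnc]
    have e4 : ‖((F - apMean g • char l : APReal) : AP2)‖ ≤ ε := by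
      refine norm_coe_le fun t => ?_
      have e5 : (F - apMean g • char l : APReal) t = Complex.exp (Complex.I * l * t) *
          ((n : ℂ)⁻¹ * ∑ i ∈ Finset.range n, g (t + i * δ) - apMean g) := by
        simp only [F, sub_apply, smul_apply, sum_apply, translate_apply, char_apply, mul_sub,
          hgdef, Pi.mul_apply]
        rw [mul_left_comm, Finset.mul_sum (a := Complex.exp _), mul_comm (apMean _)]
        congr 2
        refine Finset.sum_congr rfl fun i _ => ?_
        rw [mul_left_comm, ← Complex.exp_add, mul_comm]
        congr 2
        push_cast
        ring
      rw [e5, norm_mul, Complex.norm_exp]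
      simpa using hp t
    have e6 : inner ℂ (f : AP2) u = inner ℂ ((F - apMean g • char l : APReal) : AP2) u := by
      rw [UniformSpace.Completion.coe_sub, inner_sub_left, e1, UniformSpace.Completion.coe_smul,
        inner_smul_left, h0, mul_zero, sub_zero]
    rw [e6]
    exact (norm_inner_le_norm _ _).trans (by gcongr)
  refine norm_le_zero_iff.1 (le_of_forall_pos_le_add fun ε hε => ?_)
  refine (key (ε / (‖u‖ + 1)) (by positivity)).trans ?_
  rw [zero_add, div_mul_eq_mul_div, div_le_iff₀ (by positivity)]
  nlinarith [norm_nonneg u]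

/-- The characters span a dense subspace of `AP₂(ℝ)`. -/
theorem eq_zero_of_inner_char_eq_zero {w : AP2} (hw : ∀ μ, inner ℂ (char μ : AP2) w = 0) :
    w = 0 := by
  by_contra hne
  let N := orbit w
  let A : AP2 →L[ℂ] AP2 := (ContinuousLinearMap.adjoint N).comp N
  have hA : ∀ u v, inner ℂ (A u) v = inner ℂ (N u) (N v) := fun u v =>
    ContinuousLinearMap.adjoint_inner_left N v (N u)
  have hA' : ∀ u v, inner ℂ u (A v) = inner ℂ (N u) (N v) := fun u v =>
    ContinuousLinearMap.adjoint_inner_right N u (N v)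
  have hcomp : IsCompactOperator A :=
    (isCompactOperator_orbit w).clm_comp (ContinuousLinearMap.adjoint N)
  have hsymm : (A : AP2 →ₗ[ℂ] AP2).IsSymmetric := fun u v => (hA u v).trans (hA' u v).symm
  have hNw : N w ≠ 0 := fun h => by
    have h1 : ‖orbitₗ w w‖ = 0 := by
      rw [← UniformSpace.Completion.norm_coe, ← orbit_apply]
      exact norm_eq_zero.2 h
    have h2 := eq_zero_of_norm_eq_zero h1 0
    rw [orbitₗ_apply, shift_zero] at h2
    exact hne (inner_self_eq_zero.1 h2)
  have hA0 : A ≠ 0 := fun h => hNw <| by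
    have := hA w w
    rw [h] at this
    simpa using this.symm
  -- A nonzero compact self-adjoint operator has a nonzero eigenvalue, and compactness makes its
  -- eigenspace finite-dimensional.
  obtain ⟨μ, hμ, hμ0⟩ : ∃ μ, Module.End.HasEigenvalue (A : Module.End ℂ AP2) μ ∧ μ ≠ 0 := by
    by_contra! hall
    exact hA0 ((ContinuousLinearMap.eq_zero_of_forall_hasEigenvalue_eq_zero hcomp hsymm).1 hall)
  have hfin := ContinuousLinearMap.finite_dimensional_eigenspace hcomp μ hμ0
  have hAS : ∀ x g, A (shift x g) = shift x (A g) := fun x g => by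
    refine ext_inner_right ℂ fun v => ?_
    have e : shift x (A g) = shift (-(-x)) (A g) := by rw [neg_neg]
    rw [hA, e, inner_shift_neg, hA, orbit_shift, orbit_shift, ← inner_shift_neg, neg_neg]
  obtain ⟨u, huE, hu0, hχ⟩ := Submodule.exists_joint_eigenvector
    (fun x : ℝ => (shift x : AP2 →ₗ[ℂ] AP2))
    (fun x y v => by simp [shift_shift, add_comm]) (Module.End.eigenspace A.toLinearMap μ) hμ
    (fun x v hv => by
      rw [Module.End.mem_eigenspace_iff] at hv ⊢
      change A (shift x v) = μ • shift x v
      rw [hAS, ← map_smul]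
      exact congrArg _ hv)
  choose χ hχ using hχ
  replace hχ : ∀ x, shift x u = χ x • u := hχ
  have hun : (inner ℂ u u : ℂ) ≠ 0 := inner_self_ne_zero.2 hu0
  obtain ⟨l, hl⟩ := exists_eq_exp_of_continuous_character (χ := χ)
    (by
      have h1 : χ = fun x => inner ℂ u (shift x u) / inner ℂ u u := by
        funext x
        rw [hχ, inner_smul_right, mul_div_cancel_right₀ _ hun]
      rw [h1]
      exact (isBohrAP_inner_shift u u).1.div_const _)
    (fun x y => by
      have h1 := shift_shift x y u
      rw [hχ, map_smul, hχ, hχ, smul_smul] at h1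
      rw [← smul_left_injective ℂ hu0 h1, mul_comm])
    (fun x => by
      have h1 := norm_shift x u
      rw [hχ, norm_smul] at h1
      exact (mul_eq_right₀ (norm_ne_zero_iff.2 hu0)).1 h1)
  refine hu0 (eq_zero_of_shift_eq_exp_smul (l := l) (fun x => by rw [hχ, hl]) ?_)
  -- Here the orthogonality of `w` to the characters enters. Then `μ (char l, u) = (N (char l), N u)
  -- = 0` with `μ ≠ 0`.
  have hNl : N (char l : AP2) = 0 := by
    have h1 : orbitₗ w (char l : AP2) = 0 := by
      ext t
      rw [orbitₗ_apply, shift_char, inner_smul_right, ← inner_conj_symm, hw]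
      simp
    change ((orbitₗ w (char l : AP2) : APReal) : AP2) = 0
    rw [h1, UniformSpace.Completion.coe_zero]
  have h2 := hA' (char l : AP2) u
  have h3 : A u = μ • u := Module.End.mem_eigenspace_iff.1 huE
  rw [h3, hNl, inner_zero_left, inner_smul_right] at h2
  exact (mul_eq_zero.1 h2).resolve_left hμ0

end AP2

/-! ### Bohr's approximation theorem -/

theorem IsBohrAP.norm_apMean_le_re_apMean {f g : ℝ → ℂ} (hf : IsBohrAP f) (hg : IsBohrAP g)
    (h : ∀ t, ‖f t‖ ≤ (g t).re) : ‖apMean f‖ ≤ (apMean g).re := by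
  refine le_of_tendsto_of_tendsto hf.tendsto_mean.norm
    ((Complex.continuous_re.tendsto _).comp hg.tendsto_mean) ?_
  filter_upwards [eventually_gt_atTop 0] with T hT
  have h2 : (∫ t in (-T)..T, g t).re = ∫ t in (-T)..T, (g t).re :=
    (intervalIntegral.intervalIntegral_re (hg.1.intervalIntegrable _ _)).symm
  simp only [Function.comp_apply]
  rw [Complex.smul_re, h2, smul_eq_mul, norm_smul, norm_inv, Real.norm_eq_abs,
    abs_of_pos (by positivity)]
  gcongr
  exact intervalIntegral.norm_integral_le_of_norm_le (by linarith)
    (Eventually.of_forall fun t _ => h t)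
    ((Complex.continuous_re.comp hg.1).intervalIntegrable _ _)

/-- There is a nonnegative almost periodic weight, positive at the origin, that vanishes outside
the `ε`-almost periods of `f`. -/
theorem IsBohrAP.exists_weight {f : ℝ → ℂ} (hf : IsBohrAP f) {ε : ℝ} (hε : 0 < ε) :
    ∃ k : ℝ → ℝ, IsBohrAP (fun t => (k t : ℂ)) ∧ (∀ t, 0 ≤ k t) ∧ 0 < k 0 ∧
      ∀ t x, k t * ‖f (x + t) - f x‖ ≤ k t * ε := by
  obtain ⟨M, hM, hMf⟩ := hf.bounded
  let d : ℝ → ℝ := fun t => ⨆ x, ‖f (x + t) - f x‖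
  have hbdd : ∀ t, BddAbove (Set.range fun x => ‖f (x + t) - f x‖) := fun t =>
    ⟨2 * M, by rintro _ ⟨x, rfl⟩; exact (norm_sub_le _ _).trans (by linarith [hMf (x + t), hMf x])⟩
  have hle : ∀ t x, ‖f (x + t) - f x‖ ≤ d t := fun t x => le_ciSup (hbdd t) x
  have hd : ∀ s t η, (∀ x, ‖f (x + s) - f (x + t)‖ ≤ η) → d s ≤ d t + η := fun s t η h => by
    refine ciSup_le fun x => ?_
    have e : f (x + s) - f x = (f (x + s) - f (x + t)) + (f (x + t) - f x) := by ring
    rw [e]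
    exact (norm_add_le _ _).trans (by linarith [h x, hle t x])
  -- `d t` is the sup distance between `f` and its translate by `t`, so this weight is positive
  -- exactly at shifts that move `f` by less than `ε`.
  refine ⟨fun t => max 0 (ε - d t), ?_, fun t => le_max_left _ _, ?_, fun t x => ?_⟩
  · refine hf.of_translates (C := 1) fun s t η h => ?_
    rw [← Complex.ofReal_sub, Complex.norm_real, Real.norm_eq_abs, one_mul]
    refine (abs_max_sub_max_le_max _ _ _ _).trans ?_
    have h' := hd t s η fun x => by rw [norm_sub_rev]; exact h x
    refine max_le ?_ (abs_le.2 ⟨?_, ?_⟩)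
    · simpa using (norm_nonneg _).trans (h 0)
    · linarith [hd s t η h]
    · linarith
  · have : d 0 = 0 := by simp [d]
    simp [this, hε]
  · rcases le_or_gt (ε - d t) 0 with h | h
    · simp [h]
    · gcongr
      linarith [hle t x]

namespace AP2

open APReal

theorem span_char_dense : (Submodule.span ℂ
    (Set.range fun μ => (char μ : AP2))).topologicalClosure = ⊤ := by
  rw [Submodule.topologicalClosure_eq_top_iff, Submodule.eq_bot_iff]
  intro w hw
  exact eq_zero_of_inner_char_eq_zero fun μ =>
    (Submodule.mem_orthogonal _ _).1 hw _ (Submodule.subset_span ⟨μ, rfl⟩)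

theorem exists_trigonometric_near (g : AP2) {ε : ℝ} (hε : 0 < ε) :
    ∃ P ∈ Submodule.span ℂ (Set.range char), ‖g - (P : APReal)‖ < ε := by
  have h : g ∈ closure (Submodule.span ℂ (Set.range fun μ => (char μ : AP2)) : Set AP2) := by
    rw [← Submodule.topologicalClosure_coe, span_char_dense]
    trivial
  obtain ⟨v, hv, hd⟩ := Metric.mem_closure_iff.1 h ε hε
  have h2 : (Set.range fun μ => (char μ : AP2))
      = (UniformSpace.Completion.toComplL (𝕜 := ℂ) (E := APReal)).toLinearMap ''
        Set.range char := by
    rw [← Set.range_comp]; rfl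
  rw [SetLike.mem_coe, h2, Submodule.span_image] at hv
  obtain ⟨P, hP, rfl⟩ := hv
  exact ⟨P, hP, by rwa [dist_eq_norm] at hd⟩

theorem orbitₗ_char (w : AP2) (μ : ℝ) :
    orbitₗ w (char μ : AP2) = (inner ℂ w (char μ : AP2) : ℂ) • char μ := by
  ext t
  rw [orbitₗ_apply, shift_char, inner_smul_right, smul_apply, char_apply, mul_comm]

theorem orbitₗ_mem_span_char (w : AP2) {P : APReal} (hP : P ∈ Submodule.span ℂ (Set.range char)) :
    orbitₗ w (P : AP2) ∈ Submodule.span ℂ (Set.range char) := by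
  induction hP using Submodule.span_induction with
  | mem x hx =>
    obtain ⟨μ, rfl⟩ := hx
    rw [orbitₗ_char]
    exact Submodule.smul_mem _ _ (Submodule.subset_span ⟨μ, rfl⟩)
  | zero =>
    rw [UniformSpace.Completion.coe_zero, map_zero]
    exact Submodule.zero_mem _
  | add x y _ _ hx hy =>
    rw [UniformSpace.Completion.coe_add, map_add]
    exact Submodule.add_mem _ hx hy
  | smul c x _ hx =>
    rw [UniformSpace.Completion.coe_smul, map_smul]
    exact Submodule.smul_mem _ _ hx

end AP2

/-- **Bohr's approximation theorem**: almost periodic functions are uniform limits of trigonometric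
polynomials. -/
theorem APReal.exists_trigonometric_uniformly_near (f : APReal) {ε : ℝ} (hε : 0 < ε) :
    ∃ P ∈ Submodule.span ℂ (Set.range APReal.char), ∀ t, ‖f t - P t‖ ≤ ε := by
  obtain ⟨k, hk, hk0, hkpos, hkf⟩ := f.isBohrAP.exists_weight (half_pos hε)
  set m := apMean fun t => (k t : ℂ) with hm
  have hmre : 0 < m.re := hk.re_apMean_pos (t₀ := 0) (fun t => by simpa using hk0 t)
    (by simpa using hkpos)
  have hmn : 0 < ‖m‖ := hmre.trans_le ((le_abs_self _).trans (Complex.abs_re_le_norm m))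
  let K : APReal := APReal.mk _ hk
  -- The orbit function is the mean of `k t * f (t + x)` over `t`, and `f (t + x)` is within `ε/2`
  -- of `f x` wherever the weight is nonzero.
  have h1 : ∀ x, ‖AP2.orbitₗ K (f : AP2) x - m * f x‖ ≤ m.re * (ε / 2) := fun x => by
    have hb : ∀ c : ℂ, IsBohrAP fun t => (k t : ℂ) * c := fun c => hk.mul (isBohrAP_const c)
    have hb2 : IsBohrAP fun t => (k t : ℂ) * f (t + x) := hk.mul (f.isBohrAP.comp_add_right x)
    have e1 : AP2.orbitₗ K (f : AP2) x = apMean fun t => (k t : ℂ) * f (t + x) := by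
      rw [AP2.orbitₗ_apply, AP2.shift_coe, UniformSpace.Completion.inner_coe, APReal.inner_eq]
      congr 1
      funext t
      simp [K]
    have e2 : ∀ c : ℂ, apMean (fun t => (k t : ℂ) * c) = m * c := fun c => by
      simp only [mul_comm _ c]
      exact hk.apMean_const_mul c
    have e3 : AP2.orbitₗ K (f : AP2) x - m * f x
        = apMean fun t => (k t : ℂ) * f (t + x) + (k t : ℂ) * -f x := by
      rw [hb2.apMean_add (hb _), e1, e2]
      ring
    have e4 : m.re * (ε / 2) = (apMean fun t => (k t : ℂ) * (ε / 2 : ℝ)).re := by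
      rw [e2, Complex.re_mul_ofReal]
    rw [e3, e4]
    refine (hb2.add (hb _)).norm_apMean_le_re_apMean (hb _) fun t => ?_
    have e5 : (k t : ℂ) * f (t + x) + (k t : ℂ) * -f x = (k t : ℂ) * (f (x + t) - f x) := by
      rw [add_comm x t]; ring
    simp only [Pi.add_apply]
    rw [e5, norm_mul, Complex.norm_real, Real.norm_eq_abs, abs_of_nonneg (hk0 t),
      ← Complex.ofReal_mul, Complex.ofReal_re]
    exact hkf t x
  -- Approximation in the norm of `AP₂(ℝ)` is enough: `orbitₗ K` turns it into uniform approximation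
  -- and maps trigonometric polynomials to trigonometric polynomials.
  obtain ⟨P, hP, hPf⟩ := AP2.exists_trigonometric_near (f : AP2)
    (ε := ‖m‖ * (ε / 2) / (‖(K : AP2)‖ + 1)) (by positivity)
  refine ⟨m⁻¹ • AP2.orbitₗ K (P : AP2),
    Submodule.smul_mem _ _ (AP2.orbitₗ_mem_span_char _ hP), fun t => ?_⟩
  have h2 := AP2.norm_orbitₗ_apply_le K ((f : AP2) - P) t
  rw [lt_div_iff₀ (by positivity)] at hPf
  have hm0 : m ≠ 0 := norm_pos_iff.1 hmn
  have e : f t - (m⁻¹ • AP2.orbitₗ K (P : AP2)) t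
      = m⁻¹ * (AP2.orbitₗ K ((f : AP2) - P) t - (AP2.orbitₗ K (f : AP2) t - m * f t)) := by
    rw [map_sub, APReal.sub_apply, APReal.smul_apply]
    field_simp
    ring
  have h3 : m.re ≤ ‖m‖ := (le_abs_self _).trans (Complex.abs_re_le_norm m)
  rw [e, norm_mul, norm_inv, inv_mul_le_iff₀ hmn]
  refine (norm_sub_le _ _).trans ?_
  nlinarith [h1 t, norm_nonneg ((f : AP2) - P)]

/-! The analysis map on almost periodic functions -/

theorem IsBohrAP.integrable_mul_conj {ψ f : ℝ → ℂ} (hf : IsBohrAP f) (hψ : Integrable ψ volume)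
    (x : ℝ) : Integrable fun t => f t * (starRingEnd ℂ) (ψ (t - x)) := by
  obtain ⟨M, hM, hMf⟩ := hf.bounded
  exact (Complex.conjLIE.toContinuousLinearEquiv.integrable_comp_iff.2
    (hψ.comp_sub_right x)).bdd_mul hf.1.aestronglyMeasurable (Eventually.of_forall hMf)

/-- The analysis coefficient as a linear functional on `AP(ℝ)`. -/
def translateCoeffₗ (α : ℝ) {ψ : ℝ → ℂ} (hψ : Integrable ψ volume) (k : ℤ) : APReal →ₗ[ℂ] ℂ where
  toFun f := translateCoeff α ψ f k
  map_add' f g := by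
    simp only [translateCoeff, APReal.add_apply, add_mul]
    exact integral_add (f.isBohrAP.integrable_mul_conj hψ _) (g.isBohrAP.integrable_mul_conj hψ _)
  map_smul' c f := by
    simp only [translateCoeff, APReal.smul_apply, mul_assoc, RingHom.id_apply, smul_eq_mul]
    exact integral_const_mul _ _

theorem norm_translateCoeff_le (α : ℝ) {ψ : ℝ → ℂ} (hψ : Integrable ψ volume) {f : ℝ → ℂ} {C : ℝ}
    (hC : ∀ t, ‖f t‖ ≤ C) (k : ℤ) : ‖translateCoeff α ψ f k‖ ≤ C * ∫ t, ‖ψ t‖ := by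
  have h1 : ∫ t, ‖ψ (t - k * α)‖ = ∫ t, ‖ψ t‖ :=
    integral_sub_right_eq_self (fun t => ‖ψ t‖) (k * α)
  rw [translateCoeff, ← h1, ← integral_const_mul]
  refine norm_integral_le_of_norm_le ((hψ.comp_sub_right _).norm.const_mul C)
    (Eventually.of_forall fun t => ?_)
  rw [norm_mul, RCLike.norm_conj]
  gcongr
  exact hC t

theorem translateCoeff_add_int (α : ℝ) (ψ f : ℝ → ℂ) (n p : ℤ) :
    translateCoeff α ψ f (n + p) = translateCoeff α ψ (fun t => f (t + p * α)) n := by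
  rw [translateCoeff, translateCoeff,
    ← integral_add_right_eq_self (fun t => f t * (starRingEnd ℂ) (ψ (t - (n + p : ℤ) * α))) (p * α)]
  congr 1
  funext t
  congr 3
  push_cast
  ring

theorem translateCoeff_char (α : ℝ) (ψ : ℝ → ℂ) (μ : ℝ) (k : ℤ) :
    translateCoeff α ψ (APReal.char μ) k
      = (starRingEnd ℂ) (angularFourier ψ μ) * Complex.exp (Complex.I * μ * α) ^ k := by
  have h := translateCoeff_add_int α ψ (APReal.char μ) 0 k
  rw [zero_add] at h
  rw [h, translateCoeff, angularFourier, ← integral_conj, ← integral_mul_const]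
  congr 1
  funext t
  have e : Complex.exp (Complex.I * μ * (t + k * α : ℝ))
      = (starRingEnd ℂ) (Complex.exp (-(Complex.I * μ * t)))
        * Complex.exp (Complex.I * μ * α) ^ k := by
    rw [← Complex.exp_int_mul, ← Complex.exp_conj, ← Complex.exp_add]
    congr 1
    simp
    ring
  rw [APReal.char_apply, e, map_mul, Int.cast_zero, zero_mul, sub_zero]
  ring

/-- The chord has length `2|sin(πy)|` with `|y| ≤ 1/2`, and Jordan's inequality bounds the sine
below. It shows that almost periods of `e^{2πit/α}` lie close to `αℤ`. -/
theorem four_mul_abs_sub_round_le (x : ℝ) :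
    4 * |x - round x| ≤ ‖Complex.exp (2 * Real.pi * Complex.I * x) - 1‖ := by
  set y := x - round x with hy
  have h1 : Complex.exp (2 * Real.pi * Complex.I * x)
      = Complex.exp (Complex.I * (2 * Real.pi * y : ℝ)) := by
    rw [Complex.exp_eq_exp_iff_exists_int]
    refine ⟨round x, ?_⟩
    rw [hy]
    push_cast
    ring
  have h2 := abs_sub_round x
  have hpi := Real.pi_pos
  have h3 := Real.mul_abs_le_abs_sin (x := Real.pi * y) (by
    rw [abs_mul, abs_of_pos hpi]
    nlinarith)
  rw [h1, Complex.norm_exp_I_mul_ofReal_sub_one, Real.norm_eq_abs, abs_mul,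
    show 2 * Real.pi * y / 2 = Real.pi * y by ring, abs_two]
  rw [abs_mul, abs_of_pos hpi] at h3
  have h4 : 2 / Real.pi * (Real.pi * |y|) = 2 * |y| := by field_simp
  linarith

/-- Among the multiples of `α` there are relatively densely many almost periods. -/
theorem IsBohrAP.exists_multiple {f : ℝ → ℂ} (hf : IsBohrAP f) {α : ℝ} (hα : 0 < α) {ε : ℝ}
    (hε : 0 < ε) : ∃ N : ℕ, ∀ m : ℤ, ∃ p ∈ Finset.Ico m (m + N),
      ∀ t : ℝ, ‖f (t + p * α) - f t‖ ≤ ε := by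
  obtain ⟨δ, hδ, hu⟩ := hf.uniformContinuous (ε / 2) (half_pos hε)
  -- A common almost period `τ` of `f` and this exponential is within `δ/4` of a multiple of `α`,
  -- and by uniform continuity that multiple can replace `τ`.
  obtain ⟨L, hL, h⟩ := hf.common (isBohrAP_exp (2 * Real.pi / α)) (min (ε / 2) (δ / α))
    (lt_min (half_pos hε) (by positivity))
  -- `τ` is sought one unit inside both ends of the range, since rounding `τ / α` moves it by at
  -- most `1/2`; one further unit makes the interval longer than `L`.
  refine ⟨⌈L / α⌉₊ + 3, fun m => ?_⟩
  have hN := Nat.le_ceil (L / α)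
  rw [div_le_iff₀ hα] at hN
  obtain ⟨τ, hτ, h1, h2⟩ := h ((m + 1) * α) ((m + ⌈L / α⌉₊ + 2) * α) (by nlinarith)
  have hr := abs_le.1 (abs_sub_round (τ / α))
  have ha : (m + 1 : ℝ) < τ / α := (lt_div_iff₀ hα).2 hτ.1
  have hb : τ / α < m + ⌈L / α⌉₊ + 2 := (div_lt_iff₀ hα).2 hτ.2
  refine ⟨round (τ / α), Finset.mem_Ico.2 ⟨?_, ?_⟩, fun t => ?_⟩
  · have : (m : ℝ) < round (τ / α) := by linarith
    exact_mod_cast this.le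
  · have : (round (τ / α) : ℝ) < m + (⌈L / α⌉₊ + 3 : ℕ) := by push_cast; linarith
    exact_mod_cast this
  · have h3 := four_mul_abs_sub_round_le (τ / α)
    have h4 : ‖Complex.exp (2 * Real.pi * Complex.I * (τ / α : ℝ)) - 1‖ ≤ δ / α := by
      have := (h2 0).trans (min_le_right _ _)
      rw [zero_add, Complex.ofReal_zero, mul_zero, Complex.exp_zero] at this
      refine le_of_eq_of_le ?_ this
      congr 3
      push_cast
      ring
    have h5 : |τ - round (τ / α) * α| < δ := by
      have e : τ - round (τ / α) * α = (τ / α - round (τ / α)) * α := by field_simp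
      rw [e, abs_mul, abs_of_pos hα]
      have h6 : 4 * |τ / α - round (τ / α)| ≤ δ / α := h3.trans h4
      rw [le_div_iff₀ hα] at h6
      linarith
    have h7 := hu (t + round (τ / α) * α) (t + τ) (by
      rw [add_sub_add_left_eq_sub, abs_sub_comm]
      exact h5)
    have h8 := (h1 t).trans (min_le_left _ _)
    have e : f (t + round (τ / α) * α) - f t
        = (f (t + round (τ / α) * α) - f (t + τ)) + (f (t + τ) - f t) := by ring
    rw [e]
    exact (norm_add_le _ _).trans (by linarith)

theorem isAPSeq_translateCoeff {α : ℝ} (hα : 0 < α) {ψ : ℝ → ℂ} (hψ : Integrable ψ volume)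
    (f : APReal) : IsAPSeq (translateCoeff α ψ f) := by
  intro ε hε
  have hI : 0 ≤ ∫ t, ‖ψ t‖ := integral_nonneg fun t => norm_nonneg _
  obtain ⟨N, hN⟩ := f.isBohrAP.exists_multiple hα (ε := ε / ((∫ t, ‖ψ t‖) + 1)) (by positivity)
  refine ⟨N, fun m => ?_⟩
  obtain ⟨p, hp, h⟩ := hN m
  refine ⟨p, hp, fun n => ?_⟩
  have e : translateCoeff α ψ f (n + p) - translateCoeff α ψ f n
      = translateCoeff α ψ (APReal.translate (p * α) f - f : APReal) n := by
    rw [translateCoeff_add_int]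
    exact (map_sub (translateCoeffₗ α hψ n) (APReal.translate (p * α) f) f).symm
  rw [e]
  refine (norm_translateCoeff_le α hψ h n).trans ?_
  rw [div_mul_eq_mul_div, div_le_iff₀ (by positivity)]
  nlinarith

/-! Means of sequences -/

theorem sub_one_mul_sum_Icc_zpow {z : ℂ} (hz : z ≠ 0) (p : ℕ) :
    (z - 1) * ∑ n ∈ Finset.Icc (-(p : ℤ)) p, z ^ n = z ^ ((p : ℤ) + 1) - z ^ (-(p : ℤ)) := by
  induction p with
  | zero => simp
  | succ p ih =>
    have e : Finset.Icc (-((p + 1 : ℕ) : ℤ)) ((p + 1 : ℕ) : ℤ)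
        = insert (-((p : ℤ) + 1)) (insert ((p : ℤ) + 1) (Finset.Icc (-(p : ℤ)) p)) := by
      ext n
      simp only [Finset.mem_Icc, Finset.mem_insert]
      omega
    rw [e, Finset.sum_insert (by simp only [Finset.mem_insert, Finset.mem_Icc]; omega),
      Finset.sum_insert (by simp), mul_add, mul_add, ih]
    push_cast
    have e1 : z ^ ((p : ℤ) + 1 + 1) = z ^ ((p : ℤ) + 1) * z := zpow_add_one₀ hz _
    have e2 : z ^ (-(p : ℤ)) = z ^ (-((p : ℤ) + 1)) * z := by
      rw [← zpow_add_one₀ hz]; congr 1; ring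
    rw [e1, e2]
    ring

/-- For `z ≠ 1` the geometric sums telescope and stay bounded by `2 / ‖z - 1‖`. For `z = 1` there
are `2p + 1` terms against the factor `1 / (2p)`, which still gives `1` in the limit. -/
theorem tendsto_mean_zpow {z : ℂ} (hz : ‖z‖ = 1) :
    Tendsto (fun p : ℕ => (2 * (p : ℂ))⁻¹ * ∑ n ∈ Finset.Icc (-(p : ℤ)) p, z ^ n) atTop
      (𝓝 (if z = 1 then 1 else 0)) := by
  have hinv : Tendsto (fun p : ℕ => (2 * (p : ℂ))⁻¹) atTop (𝓝 0) := by
    have h := (tendsto_inv_atTop_nhds_zero_nat (𝕜 := ℂ)).const_mul (2 : ℂ)⁻¹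
    simp only [mul_zero] at h
    exact h.congr fun p => (mul_inv _ _).symm
  have hz0 : z ≠ 0 := fun h => by simp [h] at hz
  split_ifs with h
  · subst h
    have h1 := hinv.const_add 1
    rw [add_zero] at h1
    refine h1.congr' ?_
    filter_upwards [eventually_gt_atTop 0] with p hp
    have hpc : (p : ℂ) ≠ 0 := by exact_mod_cast hp.ne'
    simp only [one_zpow, Finset.sum_const, Int.card_Icc, nsmul_eq_mul, mul_one]
    rw [show ((p : ℤ) + 1 - -(p : ℤ)).toNat = 2 * p + 1 by omega]
    push_cast
    field_simp
  · have hz1 : z - 1 ≠ 0 := sub_ne_zero.2 h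
    refine squeeze_zero_norm (a := fun p : ℕ => ‖(2 * (p : ℂ))⁻¹‖ * (2 / ‖z - 1‖)) (fun p => ?_) ?_
    · rw [norm_mul]
      gcongr
      rw [le_div_iff₀ (norm_pos_iff.2 hz1), mul_comm, ← norm_mul, sub_one_mul_sum_Icc_zpow hz0]
      refine (norm_sub_le _ _).trans ?_
      rw [norm_zpow, norm_zpow, hz, one_zpow, one_zpow]
      norm_num
    · simpa using hinv.norm.mul_const (2 / ‖z - 1‖)

/-- The bound is uniform in `p`, as needed for exchanging limits. The factor `2` absorbs `(2p + 1) /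
(2p)`; at `p = 0` both means are zero because `0⁻¹ = 0`. -/
theorem abs_mean_sub_mean_le {a b : ℤ → ℂ} {M η : ℝ} (ha : ∀ n, ‖a n‖ ≤ M)
    (hab : ∀ n, ‖b n - a n‖ ≤ η) (p : ℕ) :
    |(2 * (p : ℝ))⁻¹ * ∑ n ∈ Finset.Icc (-(p : ℤ)) p, ‖b n‖ ^ 2
      - (2 * (p : ℝ))⁻¹ * ∑ n ∈ Finset.Icc (-(p : ℤ)) p, ‖a n‖ ^ 2| ≤ 2 * (η * (2 * M + η)) := by
  have hη : 0 ≤ η := (norm_nonneg _).trans (hab 0)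
  have hM : 0 ≤ M := (norm_nonneg _).trans (ha 0)
  rcases Nat.eq_zero_or_pos p with rfl | hp
  · simp
    positivity
  · have hp' : (1 : ℝ) ≤ p := by exact_mod_cast hp
    have h1 : ∀ n, |‖b n‖ ^ 2 - ‖a n‖ ^ 2| ≤ η * (2 * M + η) := fun n => by
      have h2 : |‖b n‖ - ‖a n‖| ≤ η := (abs_norm_sub_norm_le _ _).trans (hab n)
      have h3 := ha n
      have h4 := (abs_le.1 h2).2
      rw [sq_sub_sq, abs_mul, mul_comm]
      refine mul_le_mul h2 ?_ (abs_nonneg _) hη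
      rw [abs_of_nonneg (by positivity)]
      linarith
    rw [← mul_sub, ← Finset.sum_sub_distrib, abs_mul, abs_of_pos (by positivity),
      inv_mul_le_iff₀ (by positivity)]
    refine (Finset.abs_sum_le_sum_abs _ _).trans ((Finset.sum_le_sum fun n _ => h1 n).trans ?_)
    rw [Finset.sum_const, Int.card_Icc, show ((p : ℤ) + 1 - -(p : ℤ)).toNat = 2 * p + 1 by omega,
      nsmul_eq_mul]
    push_cast
    have : 0 ≤ η * (2 * M + η) := by positivity
    nlinarith

/-! Bounded orthogonal families -/

/-- Bessel's inequality without normalization, which allows zero vectors. With `v = ∑ (h i, f) h i`,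
the sum `S` equals `(v, f)`, while `‖v‖² ≤ B S` by orthogonality; Cauchy–Schwarz then gives `S² ≤ B
S ‖f‖²`. -/
theorem sum_norm_sq_inner_le_of_orthogonal {ι E : Type*} [NormedAddCommGroup E]
    [InnerProductSpace ℂ E] {h : ι → E} (horth : ∀ i j, i ≠ j → inner ℂ (h i) (h j) = 0) {B : ℝ}
    (hB0 : 0 ≤ B) (hB : ∀ i, ‖h i‖ ^ 2 ≤ B) (s : Finset ι) (f : E) :
    ∑ i ∈ s, ‖inner ℂ (h i) f‖ ^ 2 ≤ B * ‖f‖ ^ 2 := by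
  set S := ∑ i ∈ s, ‖inner ℂ (h i) f‖ ^ 2 with hS
  set v := ∑ i ∈ s, (inner ℂ (h i) f : ℂ) • h i with hv
  have hS0 : 0 ≤ S := Finset.sum_nonneg fun i _ => by positivity
  have h1 : inner ℂ v f = (S : ℂ) := by
    rw [hv, sum_inner, hS, Complex.ofReal_sum]
    refine Finset.sum_congr rfl fun i _ => ?_
    rw [inner_smul_left, ← Complex.normSq_eq_conj_mul_self, Complex.normSq_eq_norm_sq]
  have h2 : ‖v‖ ^ 2 ≤ B * S := by
    have h3 : inner ℂ v v = ((∑ i ∈ s, ‖inner ℂ (h i) f‖ ^ 2 * ‖h i‖ ^ 2 : ℝ) : ℂ) := by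
      rw [hv, sum_inner, Complex.ofReal_sum]
      refine Finset.sum_congr rfl fun i hi => ?_
      rw [inner_sum, Finset.sum_eq_single i]
      · rw [inner_smul_left, inner_smul_right, ← mul_assoc, ← Complex.normSq_eq_conj_mul_self,
          Complex.normSq_eq_norm_sq, inner_self_eq_norm_sq_to_K]
        push_cast
        rfl
      · intro j _ hji
        rw [inner_smul_left, inner_smul_right, horth i j hji.symm]
        simp
      · intro hi'
        exact absurd hi hi'
    have h4 : ‖v‖ ^ 2 = ∑ i ∈ s, ‖inner ℂ (h i) f‖ ^ 2 * ‖h i‖ ^ 2 := by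
      rw [← inner_self_eq_norm_sq (𝕜 := ℂ), h3]
      exact Complex.ofReal_re _
    rw [h4, hS, Finset.mul_sum]
    refine Finset.sum_le_sum fun i _ => ?_
    rw [mul_comm]
    gcongr
    exact hB i
  have h5 : S ≤ ‖v‖ * ‖f‖ := by
    have := norm_inner_le_norm (𝕜 := ℂ) v f
    rwa [h1, Complex.norm_real, Real.norm_eq_abs, abs_of_nonneg hS0] at this
  rcases hS0.eq_or_lt with h0 | hpos
  · rw [← h0]
    positivity
  · have h6 : S * S ≤ B * ‖f‖ ^ 2 * S := by
      calc S * S ≤ (‖v‖ * ‖f‖) * (‖v‖ * ‖f‖) := by gcongr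
        _ = ‖v‖ ^ 2 * ‖f‖ ^ 2 := by ring
        _ ≤ B * S * ‖f‖ ^ 2 := by gcongr
        _ = _ := by ring
    exact le_of_mul_le_mul_right h6 hpos

/-- The coefficient map `f ↦ ((h i, f))_i` of a bounded orthogonal family, with values in `ℓ²`. -/
def orthogonalCoeff {ι E : Type*} [NormedAddCommGroup E] [InnerProductSpace ℂ E] {h : ι → E}
    (horth : ∀ i j, i ≠ j → inner ℂ (h i) (h j) = 0) {B : ℝ} (hB0 : 0 ≤ B)
    (hB : ∀ i, ‖h i‖ ^ 2 ≤ B) : E →L[ℂ] lp (fun _ : ι => ℂ) 2 :=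
  LinearMap.mkContinuous
    { toFun := fun f => ⟨fun i => inner ℂ (h i) f, memℓp_gen <| by
        simpa using summable_of_sum_le (fun i => by positivity)
          fun s => sum_norm_sq_inner_le_of_orthogonal horth hB0 hB s f⟩
      map_add' := fun f g => by ext i; exact inner_add_right _ _ _
      map_smul' := fun c f => by ext i; exact inner_smul_right _ _ _ }
    (√B) fun f => by
      refine lp.norm_le_of_forall_sum_le (by simp) (by positivity) fun s => ?_
      have h1 := sum_norm_sq_inner_le_of_orthogonal horth hB0 hB s f
      simpa [mul_pow, Real.sq_sqrt hB0] using h1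

@[simp]
theorem orthogonalCoeff_apply {ι E : Type*} [NormedAddCommGroup E] [InnerProductSpace ℂ E]
    {h : ι → E} (horth : ∀ i j, i ≠ j → inner ℂ (h i) (h j) = 0) {B : ℝ} (hB0 : 0 ≤ B)
    (hB : ∀ i, ‖h i‖ ^ 2 ≤ B) (f : E) (i : ι) :
    orthogonalCoeff horth hB0 hB f i = inner ℂ (h i) f := rfl

theorem hasSum_norm_sq_lp_two {ι : Type*} (v : lp (fun _ : ι => ℂ) 2) :
    HasSum (fun i => ‖v i‖ ^ 2) (‖v‖ ^ 2) := by
  simpa using lp.hasSum_norm (p := 2) (by simp) v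

/-! The orthogonal system -/

namespace AP2

open APReal

theorem orthonormal_char : Orthonormal ℂ fun μ : ℝ => (char μ : AP2) := by
  classical
  rw [orthonormal_iff_ite]
  intro μ ν
  rw [UniformSpace.Completion.inner_coe, inner_char_char]

theorem injective_add_mul_int {w : ℝ} (hw : 0 < w) (l : ℝ) :
    Function.Injective fun p : ℤ => l + w * p := fun p q h => by
  have h1 := mul_left_cancel₀ hw.ne' (add_left_cancel h)
  exact_mod_cast h1

/-- The vector `∑_p c(l + wp) exp(i(l + wp)·)` of `AP₂(ℝ)`. -/
def fiberVector (c : ℝ → ℂ) (w l : ℝ) : AP2 := ∑' p : ℤ, c (l + w * p) • (char (l + w * p) : AP2)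

variable {c : ℝ → ℂ} {w : ℝ}

theorem hasSum_fiberVector (hw : 0 < w) {l : ℝ}
    (hs : Summable fun p : ℤ => ‖c (l + w * p)‖ ^ 2) :
    HasSum (fun p : ℤ => c (l + w * p) • (char (l + w * p) : AP2)) (fiberVector c w l) := by
  have h1 : Orthonormal ℂ fun p : ℤ => (char (l + w * p) : AP2) :=
    orthonormal_char.comp _ (injective_add_mul_int hw l)
  exact ((h1.orthogonalFamily.summable_iff_norm_sq_summable fun p => c (l + w * p)).2 hs).hasSum

theorem hasSum_inner_fiberVector (hw : 0 < w) {l : ℝ}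
    (hs : Summable fun p : ℤ => ‖c (l + w * p)‖ ^ 2) (v : AP2) :
    HasSum (fun p : ℤ => c (l + w * p) * inner ℂ v (char (l + w * p) : AP2))
      (inner ℂ v (fiberVector c w l)) := by
  simpa [inner_smul_right] using (hasSum_fiberVector hw hs).mapL (innerSL ℂ v)

theorem inner_fiberVector_char_self (hw : 0 < w) {l : ℝ}
    (hs : Summable fun p : ℤ => ‖c (l + w * p)‖ ^ 2) (q : ℤ) :
    inner ℂ (fiberVector c w l) (char (l + w * q) : AP2)
      = (starRingEnd ℂ) (c (l + w * q)) := by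
  rw [← inner_conj_symm]
  congr 1
  refine (hasSum_inner_fiberVector hw hs _).unique ?_
  have h1 := hasSum_single (f := fun p : ℤ => c (l + w * p) *
    inner ℂ (char (l + w * q) : AP2) (char (l + w * p) : AP2)) q fun p hp => by
      rw [UniformSpace.Completion.inner_coe, inner_char_char,
        if_neg fun h => hp (injective_add_mul_int hw l h).symm, mul_zero]
  rwa [UniformSpace.Completion.inner_coe, inner_char_char, if_pos rfl, mul_one] at h1

theorem inner_fiberVector_char_of_ne (hw : 0 < w) {l : ℝ}
    (hs : Summable fun p : ℤ => ‖c (l + w * p)‖ ^ 2) {μ : ℝ} (hμ : ∀ p : ℤ, μ ≠ l + w * p) :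
    inner ℂ (fiberVector c w l) (char μ : AP2) = 0 := by
  rw [← inner_conj_symm, map_eq_zero]
  refine (hasSum_inner_fiberVector hw hs _).unique ?_
  convert! hasSum_zero using 2 with p
  rw [UniformSpace.Completion.inner_coe, inner_char_char, if_neg (hμ p), mul_zero]

theorem norm_sq_fiberVector (hw : 0 < w) {l : ℝ}
    (hs : Summable fun p : ℤ => ‖c (l + w * p)‖ ^ 2) :
    ‖fiberVector c w l‖ ^ 2 = ∑' p : ℤ, ‖c (l + w * p)‖ ^ 2 := by
  have h1 := hasSum_inner_fiberVector hw hs (fiberVector c w l)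
  simp only [inner_fiberVector_char_self hw hs, Complex.mul_conj, Complex.normSq_eq_norm_sq] at h1
  rw [inner_self_eq_norm_sq_to_K] at h1
  have h2 : HasSum (fun p : ℤ => ‖c (l + w * p)‖ ^ 2) (‖fiberVector c w l‖ ^ 2) := by
    rw [← Complex.hasSum_ofReal]
    convert! h1 using 1
    push_cast
    rfl
  exact h2.tsum_eq.symm

theorem eq_of_add_mul_int_eq {l l' : ℝ} (hl : l ∈ Set.Ico 0 w) (hl' : l' ∈ Set.Ico 0 w) {p q : ℤ}
    (h : l + w * p = l' + w * q) : l = l' := by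
  have hw : 0 < w := hl.1.trans_lt hl.2
  have h1 : l - l' = w * (q - p : ℤ) := by push_cast; linarith
  have h2 : (q - p : ℤ) = 0 := by
    have h3 : (-1 : ℝ) < (q - p : ℤ) := by
      by_contra! h4
      nlinarith [hl.1, hl'.2]
    have h4 : ((q - p : ℤ) : ℝ) < 1 := by
      by_contra! h5
      nlinarith [hl.2, hl'.1]
    have h3' : (-1 : ℤ) < q - p := by exact_mod_cast h3
    have h4' : q - p < (1 : ℤ) := by exact_mod_cast h4
    omega
  rw [h2] at h1
  simp only [Int.cast_zero, mul_zero] at h1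
  linarith

/-- The frequencies `l + wℤ` and `l' + wℤ` are disjoint cosets. -/
theorem inner_fiberVector_fiberVector (hs : ∀ l, Summable fun p : ℤ => ‖c (l + w * p)‖ ^ 2)
    {l l' : ℝ} (hl : l ∈ Set.Ico 0 w) (hl' : l' ∈ Set.Ico 0 w) (hne : l ≠ l') :
    inner ℂ (fiberVector c w l) (fiberVector c w l') = 0 := by
  have hw : 0 < w := hl.1.trans_lt hl.2
  refine (hasSum_inner_fiberVector hw (hs l') _).unique ?_
  convert! hasSum_zero using 2 with q
  rw [inner_fiberVector_char_of_ne hw (hs l) fun p h => hne (eq_of_add_mul_int_eq hl hl' h.symm),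
    mul_zero]

/-- The representative of a frequency modulo `w`. -/
def residue (hw : 0 < w) (μ : ℝ) : Set.Ico (0 : ℝ) w :=
  ⟨toIcoMod hw 0 μ, by simpa using toIcoMod_mem_Ico hw 0 μ⟩

theorem residue_add (hw : 0 < w) (μ : ℝ) : (residue hw μ : ℝ) + w * toIcoDiv hw 0 μ = μ := by
  have h := toIcoMod_add_toIcoDiv_zsmul hw 0 μ
  rw [zsmul_eq_mul, mul_comm] at h
  exact h

theorem inner_fiberVector_char (hw : 0 < w) (hs : ∀ l, Summable fun p : ℤ => ‖c (l + w * p)‖ ^ 2)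
    (i : Set.Ico (0 : ℝ) w) (μ : ℝ) : inner ℂ (fiberVector c w i) (char μ : AP2)
      = if i = residue hw μ then (starRingEnd ℂ) (c μ) else 0 := by
  have hμ := residue_add hw μ
  split_ifs with h
  · have h1 := inner_fiberVector_char_self hw (hs i) (toIcoDiv hw 0 μ)
    rw [h, hμ] at h1
    rw [h]
    exact h1
  · refine inner_fiberVector_char_of_ne hw (hs i) fun p hp => h (Subtype.ext ?_)
    exact eq_of_add_mul_int_eq i.2 (residue hw μ).2 (hp.symm.trans hμ.symm)

end AP2

/-! ### The square mean of the coefficient sequence -/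

namespace AP2

open APReal

/-- Two frequencies lie in the same fibre exactly when sampling on `αℤ` cannot tell their characters
apart. This matches the surviving cross terms of the square mean with the inner products of the
vectors `T (char μ)`. -/
theorem residue_eq_residue_iff {α : ℝ} (hα : 0 < α) (hw : 0 < 2 * Real.pi / α) (μ ν : ℝ) :
    residue hw μ = residue hw ν ↔
      Complex.exp (Complex.I * μ * α) * (starRingEnd ℂ) (Complex.exp (Complex.I * ν * α)) = 1 := by
  have hαc : (α : ℂ) ≠ 0 := by exact_mod_cast hα.ne'
  have hpi : (Real.pi : ℂ) ≠ 0 := by exact_mod_cast Real.pi_ne_zero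
  have e : Complex.exp (Complex.I * μ * α) * (starRingEnd ℂ) (Complex.exp (Complex.I * ν * α))
      = Complex.exp (Complex.I * (μ - ν) * α) := by
    rw [← Complex.exp_conj, ← Complex.exp_add]
    congr 1
    simp
    ring
  rw [e, Complex.exp_eq_one_iff, residue, residue, Subtype.mk.injEq, eq_comm,
    toIcoMod_eq_toIcoMod]
  refine exists_congr fun n => ?_
  rw [zsmul_eq_mul, ← Complex.ofReal_inj]
  push_cast
  rw [← mul_div_assoc, eq_div_iff hαc]
  exact ⟨fun h => by linear_combination Complex.I * h,
    fun h => mul_left_cancel₀ Complex.I_ne_zero (by linear_combination h)⟩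

/-- The square mean of the coefficient sequence of a trigonometric polynomial. -/
theorem tendsto_mean_translateCoeff_of_mem_span {α : ℝ} (hα : 0 < α) {ψ : ℝ → ℂ}
    (hψ : Integrable ψ volume) (hw : 0 < 2 * Real.pi / α)
    (T : AP2 →L[ℂ] lp (fun _ : Set.Ico (0 : ℝ) (2 * Real.pi / α) => ℂ) 2)
    (hT : ∀ μ i, T (char μ : AP2) i
      = if i = residue hw μ then (starRingEnd ℂ) (angularFourier ψ μ) else 0)
    {P : APReal} (hP : P ∈ Submodule.span ℂ (Set.range char)) :
    Tendsto (fun p : ℕ => (2 * (p : ℝ))⁻¹ *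
      ∑ n ∈ Finset.Icc (-(p : ℤ)) p, ‖translateCoeff α ψ P n‖ ^ 2) atTop (𝓝 (‖T (P : AP2)‖ ^ 2)) := by
  classical
  obtain ⟨b, rfl⟩ := Finsupp.mem_span_range_iff_exists_finsupp.1 hP
  rw [Finsupp.sum]
  set F := b.support
  let z : ℝ → ℂ := fun μ => Complex.exp (Complex.I * μ * α)
  let d : ℝ → ℂ := fun μ => b μ * (starRingEnd ℂ) (angularFourier ψ μ)
  have hz : ∀ μ, ‖z μ‖ = 1 := fun μ => by simp [z, Complex.norm_exp]
  have e1 : ∀ n : ℤ, translateCoeff α ψ (∑ μ ∈ F, b μ • char μ : APReal) n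
      = ∑ μ ∈ F, d μ * z μ ^ n := fun n => by
    refine (map_sum (translateCoeffₗ α hψ n) _ _).trans (Finset.sum_congr rfl fun μ _ => ?_)
    rw [map_smul, smul_eq_mul, mul_assoc]
    exact congrArg _ (translateCoeff_char α ψ μ n)
  have e2 : ∀ n : ℤ, ((‖∑ μ ∈ F, d μ * z μ ^ n‖ ^ 2 : ℝ) : ℂ)
      = ∑ μ ∈ F, ∑ ν ∈ F, d μ * (starRingEnd ℂ) (d ν) * (z μ * (starRingEnd ℂ) (z ν)) ^ n :=
    fun n => by
      rw [← Complex.normSq_eq_norm_sq, ← Complex.mul_conj, map_sum, Finset.sum_mul_sum]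
      refine Finset.sum_congr rfl fun μ _ => Finset.sum_congr rfl fun ν _ => ?_
      rw [map_mul, map_zpow₀, mul_zpow]
      ring
  have e3 : ∀ μ ν, inner ℂ (T (char ν : AP2)) (T (char μ : AP2)) =
      if residue hw μ = residue hw ν then
        (starRingEnd ℂ) (angularFourier ψ μ) * angularFourier ψ ν else 0 := fun μ ν => by
    -- `T` sends a character to a vector supported at its residue, so inner products vanish unless
    -- residues agree.
    have hs : ∀ μ, T (char μ : AP2)
        = lp.single 2 (residue hw μ) ((starRingEnd ℂ) (angularFourier ψ μ)) := fun μ => by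
      ext i
      rw [hT, lp.single_apply, Pi.single_apply]
    rw [hs ν, lp.inner_single_left, hT]
    split_ifs with h1 h2 h2
    · simp
    · exact absurd h1.symm h2
    · exact absurd h2.symm h1
    · simp
  have e4 : ((‖T ((∑ μ ∈ F, b μ • char μ : APReal) : AP2)‖ ^ 2 : ℝ) : ℂ)
      = ∑ μ ∈ F, ∑ ν ∈ F, d μ * (starRingEnd ℂ) (d ν) *
        (if z μ * (starRingEnd ℂ) (z ν) = 1 then 1 else 0) := by
    have h1 : ((∑ μ ∈ F, b μ • char μ : APReal) : AP2) = ∑ μ ∈ F, b μ • (char μ : AP2) := by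
      refine (map_sum (UniformSpace.Completion.toComplL (𝕜 := ℂ) (E := APReal))
        (fun μ => b μ • char μ) F).trans (Finset.sum_congr rfl fun μ _ => ?_)
      exact map_smul (UniformSpace.Completion.toComplL (𝕜 := ℂ) (E := APReal)) _ _
    have h2 := inner_self_eq_norm_sq_to_K (𝕜 := ℂ) (T (∑ μ ∈ F, b μ • (char μ : AP2)))
    rw [h1, Complex.ofReal_pow]
    refine h2.symm.trans ?_
    rw [map_sum, sum_inner, Finset.sum_comm]
    simp only [inner_sum]
    refine Finset.sum_congr rfl fun ν _ => Finset.sum_congr rfl fun μ _ => ?_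
    rw [map_smul, map_smul, inner_smul_left, inner_smul_right, e3]
    simp only [residue_eq_residue_iff hα hw]
    simp only [d, z, map_mul, Complex.conj_conj]
    split_ifs <;> ring
  have h5 : Tendsto (fun p : ℕ => ((((2 * (p : ℝ))⁻¹ * ∑ n ∈ Finset.Icc (-(p : ℤ)) p,
      ‖∑ μ ∈ F, d μ * z μ ^ n‖ ^ 2 : ℝ)) : ℂ)) atTop
      (𝓝 ((‖T ((∑ μ ∈ F, b μ • char μ : APReal) : AP2)‖ ^ 2 : ℝ) : ℂ)) := by
    rw [e4]
    have h6 := tendsto_finsetSum F fun μ _ => tendsto_finsetSum F fun ν _ =>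
      (tendsto_mean_zpow (z := z μ * (starRingEnd ℂ) (z ν))
        (by rw [norm_mul, RCLike.norm_conj, hz, hz, mul_one])).const_mul
          (d μ * (starRingEnd ℂ) (d ν))
    refine h6.congr fun p => ?_
    rw [Complex.ofReal_mul, Complex.ofReal_sum]
    simp only [e2]
    rw [Finset.sum_comm (s := Finset.Icc _ _), Finset.mul_sum]
    refine Finset.sum_congr rfl fun μ _ => ?_
    rw [Finset.sum_comm (s := Finset.Icc _ _), Finset.mul_sum]
    refine Finset.sum_congr rfl fun ν _ => ?_
    rw [← Finset.mul_sum]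
    push_cast
    ring
  have h7 := (Complex.continuous_re.tendsto _).comp h5
  simp only [e1]
  exact h7

/-- Uniform approximation of `f` by trigonometric polynomials approximates the square means
uniformly in the window size, so the limits in `j` and `p` may be exchanged. -/
theorem hasAPSeqNorm_translateCoeff {α : ℝ} (hα : 0 < α) {ψ : ℝ → ℂ}
    (hψ : Integrable ψ volume) (hw : 0 < 2 * Real.pi / α)
    (T : AP2 →L[ℂ] lp (fun _ : Set.Ico (0 : ℝ) (2 * Real.pi / α) => ℂ) 2)
    (hT : ∀ μ i, T (char μ : AP2) i
      = if i = residue hw μ then (starRingEnd ℂ) (angularFourier ψ μ) else 0) (f : APReal) :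
    HasAPSeqNorm (translateCoeff α ψ f) ‖T (f : AP2)‖ := by
  refine ⟨norm_nonneg _, ?_⟩
  have hI : 0 ≤ ∫ t, ‖ψ t‖ := integral_nonneg fun t => norm_nonneg _
  obtain ⟨M, hM, hMf⟩ := f.isBohrAP.bounded
  choose P hP hPf using fun j : ℕ =>
    f.exists_trigonometric_uniformly_near (ε := 1 / ((j : ℝ) + 1)) (by positivity)
  have hη : Tendsto (fun j : ℕ => 1 / ((j : ℝ) + 1)) atTop (𝓝 0) :=
    tendsto_one_div_add_atTop_nhds_zero_nat
  have hlim : Tendsto (fun j => ‖T (P j : AP2)‖ ^ 2) atTop (𝓝 (‖T (f : AP2)‖ ^ 2)) := by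
    refine ((T.continuous.tendsto _).comp ?_).norm.pow 2
    rw [tendsto_iff_norm_sub_tendsto_zero]
    refine squeeze_zero (fun _ => norm_nonneg _) (fun j => ?_) hη
    rw [norm_sub_rev, ← UniformSpace.Completion.coe_sub]
    exact norm_coe_le (hPf j)
  refine TendstoUniformly.tendsto_of_eventually_tendsto (p := atTop)
    (F := fun (j : ℕ) (p : ℕ) => (2 * (p : ℝ))⁻¹ *
      ∑ n ∈ Finset.Icc (-(p : ℤ)) p, ‖translateCoeff α ψ (P j) n‖ ^ 2) ?_
    (Eventually.of_forall fun j =>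
      tendsto_mean_translateCoeff_of_mem_span hα hψ hw T hT (hP j)) hlim
  set I := ∫ t, ‖ψ t‖ with hIdef
  have hbound : ∀ j p : ℕ, |(2 * (p : ℝ))⁻¹ *
      ∑ n ∈ Finset.Icc (-(p : ℤ)) p, ‖translateCoeff α ψ (P j) n‖ ^ 2 - (2 * (p : ℝ))⁻¹ *
      ∑ n ∈ Finset.Icc (-(p : ℤ)) p, ‖translateCoeff α ψ f n‖ ^ 2|
      ≤ 2 * ((1 / ((j : ℝ) + 1) * I) * (2 * (M * I) + 1 / ((j : ℝ) + 1) * I)) := fun j p =>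
    abs_mean_sub_mean_le (norm_translateCoeff_le α hψ hMf) (fun n => by
      rw [norm_sub_rev]
      have e : translateCoeff α ψ f n - translateCoeff α ψ (P j) n
          = translateCoeff α ψ (f - P j : APReal) n := (map_sub (translateCoeffₗ α hψ n) _ _).symm
      rw [e]
      exact norm_translateCoeff_le α hψ (hPf j) n) p
  have hz : Tendsto (fun j : ℕ => 2 * ((1 / ((j : ℝ) + 1) * I) *
      (2 * (M * I) + 1 / ((j : ℝ) + 1) * I))) atTop (𝓝 0) := by
    have h1 := (((hη.mul_const I).mul ((hη.mul_const I).const_add (2 * (M * I)))).const_mul 2)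
    simpa using h1
  rw [Metric.tendstoUniformly_iff]
  intro ε hε
  filter_upwards [hz.eventually_lt_const hε] with j hj p
  rw [dist_comm, Real.dist_eq]
  exact (hbound j p).trans_lt hj

end AP2

/-! The Wiener space -/

/-- Functions in `W₀` are dominated by a summable sequence over the unit cells. -/
theorem MemW0.exists_summable_floor {φ : ℝ → ℂ} (hφ : MemW0 φ) :
    ∃ σ : ℤ → ℝ, Summable σ ∧ ∀ y : ℝ, ‖φ y‖ ≤ σ ⌊y⌋ := by
  obtain ⟨hc, hW⟩ := hφ
  have hs : ∀ k : ℤ, eLpNormEssSup (fun x : ℝ => φ (x - k)) (volume.restrict (Set.Icc 0 1)) ≠ ⊤ :=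
    ENNReal.ne_top_of_tsum_ne_top hW.ne
  have hsum := (ENNReal.summable_toReal hW.ne).comp_injective neg_injective
  refine ⟨_, hsum, fun y => ?_⟩
  simp only [Function.comp_apply]
  set k : ℤ := -⌊y⌋ with hk
  set s := eLpNormEssSup (fun x : ℝ => φ (x - k)) (volume.restrict (Set.Icc 0 1)) with hsdef
  have hcont : Continuous fun x : ℝ => ‖φ (x - k)‖ₑ := by fun_prop
  have hae : ∀ᵐ x : ℝ ∂volume.restrict (Set.Icc 0 1), ‖φ (x - k)‖ₑ ≤ s :=
    enorm_ae_le_eLpNormEssSup _ _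
  -- By continuity an excess over the essential supremum would occur on a nonempty open subset of
  -- `(0, 1)`, which has positive measure.
  have hall : ∀ x ∈ Set.Icc (0 : ℝ) 1, ‖φ (x - k)‖ₑ ≤ s := by
    by_contra! hex
    obtain ⟨x, hx, hlt⟩ := hex
    have hU : IsOpen {x : ℝ | s < ‖φ (x - k)‖ₑ} := isOpen_lt continuous_const hcont
    rw [← closure_Ioo (zero_ne_one' ℝ)] at hx
    obtain ⟨y, hyU, hy⟩ := mem_closure_iff.1 hx _ hU hlt
    have hpos := (hU.inter (isOpen_Ioo (a := (0 : ℝ)) (b := 1))).measure_pos volume ⟨y, hyU, hy⟩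
    refine hpos.ne' (measure_mono_null ?_ ((ae_restrict_iff' measurableSet_Icc).1 hae))
    rintro z ⟨hz, hz'⟩
    simp only [Set.mem_compl_iff, Set.mem_ofPred_eq, not_forall, not_le]
    exact ⟨Set.Ioo_subset_Icc_self hz', hz⟩
  have h1 := hall (Int.fract y) ⟨Int.fract_nonneg y, (Int.fract_lt_one y).le⟩
  have h2 : Int.fract y - (k : ℝ) = y := by
    rw [hk]
    push_cast
    linarith [Int.fract_add_floor y]
  rw [h2] at h1
  have h3 := ENNReal.toReal_mono (hs k) h1
  rwa [toReal_enorm] at h3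

/-- For small `α` the map `k ↦ ⌊kα⌋` is not injective. With `mα > 1` it is strictly increasing on
each residue class modulo `m`, and there are finitely many classes. -/
theorem Summable.comp_floor_mul {σ : ℤ → ℝ} (hσ : Summable σ) (h0 : ∀ j, 0 ≤ σ j) {α : ℝ}
    (hα : 0 < α) (i : ℤ) : Summable fun k : ℤ => σ (⌊k * α⌋ + i) := by
  obtain ⟨m, hm⟩ := exists_nat_gt (1 / α)
  rw [div_lt_iff₀ hα] at hm
  have : NeZero m := ⟨by rintro rfl; norm_num at hm⟩
  rw [← ((Equiv.prodComm _ _).trans (Int.divModEquiv m).symm).summable_iff]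
  refine (summable_prod_of_nonneg fun x => h0 _).2 ⟨fun r => ?_, Summable.of_finite⟩
  refine hσ.comp_injective (i := fun q : ℤ =>
    ⌊(((Int.divModEquiv m).symm (q, r) : ℤ) : ℝ) * α⌋ + i) (StrictMono.injective ?_)
  refine strictMono_int_of_lt_succ fun q => ?_
  gcongr
  rw [← Int.add_one_le_iff, ← Int.floor_add_one]
  refine Int.floor_le_floor ?_
  simp only [Int.divModEquiv_symm_apply]
  push_cast
  nlinarith

/-- Functions in `W₀` have summable local suprema along every lattice. -/
theorem MemW0.exists_summable_translates {φ : ℝ → ℂ} (hφ : MemW0 φ) {α : ℝ} (hα : 0 < α) (R : ℝ) :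
    ∃ u : ℤ → ℝ, Summable u ∧ ∀ (k : ℤ) (x : ℝ), |x| ≤ R → ‖φ (x + k * α)‖ ≤ u k := by
  obtain ⟨σ, hσ, hle⟩ := hφ.exists_summable_floor
  have h0 : ∀ j, 0 ≤ σ j := fun j => by
    simpa using (norm_nonneg _).trans (hle (j : ℝ))
  -- Adding `x` with `|x| ≤ R` moves the floor by at most `⌈R⌉ + 1`.
  refine ⟨fun k => ∑ i ∈ Finset.Icc (-(⌈R⌉ + 1)) (⌈R⌉ + 1), σ (⌊k * α⌋ + i),
    summable_sum fun i _ => hσ.comp_floor_mul h0 hα i, fun k x hx => (hle _).trans ?_⟩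
  have hR := Int.le_ceil R
  have hx' := abs_le.1 hx
  have a1 := Int.floor_le (x + k * α)
  have a2 := Int.lt_floor_add_one (x + k * α)
  have a3 := Int.floor_le (k * α)
  have a4 := Int.lt_floor_add_one (k * α)
  have hmem : ⌊x + k * α⌋ - ⌊k * α⌋ ∈ Finset.Icc (-(⌈R⌉ + 1)) (⌈R⌉ + 1) := by
    rw [Finset.mem_Icc]
    constructor
    · have : (-(⌈R⌉ + 1) : ℝ) ≤ ⌊x + k * α⌋ - ⌊k * α⌋ := by linarith
      exact_mod_cast this
    · have : (⌊x + k * α⌋ - ⌊k * α⌋ : ℝ) ≤ ⌈R⌉ + 1 := by linarith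
      exact_mod_cast this
  have h1 := Finset.single_le_sum (f := fun i => σ (⌊k * α⌋ + i)) (fun i _ => h0 _) hmem
  simpa using h1

theorem MemW0.integrable {φ : ℝ → ℂ} (hφ : MemW0 φ) : Integrable φ := by
  obtain ⟨u, hu, hle⟩ := hφ.exists_summable_translates one_pos 1
  refine Real.integrable_of_summable_norm_Icc (f := ⟨φ, hφ.1⟩)
    (Summable.of_nonneg_of_le (fun n => norm_nonneg _) (fun n => ?_) hu)
  refine (ContinuousMap.norm_le _ ((norm_nonneg _).trans (hle n 0 (by simp)))).2 fun x => ?_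
  have hx := x.2
  simpa using hle n x (abs_le.2 ⟨by linarith [hx.1], hx.2⟩)

theorem angularFourier_congr_ae {ψ φ : ℝ → ℂ} (h : ψ =ᵐ[volume] φ) :
    angularFourier ψ = angularFourier φ := by
  funext ω
  refine integral_congr_ae ?_
  filter_upwards [h] with t ht
  rw [ht]

/-- Fourier inversion. -/
theorem angularFourier_angularFourier {φ : ℝ → ℂ} (hc : Continuous φ) (hi : Integrable φ)
    (hF : Integrable (angularFourier φ)) (ω : ℝ) :
    angularFourier (angularFourier φ) ω = 2 * Real.pi * φ (-ω) := by
  have hpi : (0 : ℝ) < 2 * Real.pi := by positivity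
  have h1 : ∀ w, FourierTransform.fourier φ w = angularFourier φ (2 * Real.pi * w) := fun w => by
    rw [Real.fourier_real_eq_integral_exp_smul, angularFourier]
    congr 1
    funext t
    rw [smul_eq_mul, mul_comm]
    congr 2
    push_cast
    ring
  have h2 : Integrable (FourierTransform.fourier φ) := by
    rw [funext h1]
    exact hF.comp_mul_left' hpi.ne'
  have h3 := congrFun (hc.fourierInv_fourier_eq hi h2) (-ω)
  rw [Real.fourierInv_eq'] at h3
  have h4 : ∀ v : ℝ, Complex.exp ((2 * Real.pi * inner ℝ v (-ω) : ℝ) * Complex.I) •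
      FourierTransform.fourier φ v = (fun t : ℝ => angularFourier φ t *
        Complex.exp (-(Complex.I * ω * t))) (2 * Real.pi * v) := fun v => by
    simp only [h1, smul_eq_mul]
    rw [mul_comm]
    congr 2
    simp
    ring
  rw [funext h4, Measure.integral_comp_mul_left (fun t : ℝ => angularFourier φ t *
    Complex.exp (-(Complex.I * ω * t))), abs_of_pos (inv_pos.2 hpi), Complex.real_smul] at h3
  rw [← h3, angularFourier]
  have : ((2 * Real.pi : ℝ) : ℂ) ≠ 0 := by exact_mod_cast hpi.ne'
  push_cast at this ⊢
  field_simp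

/-! Continuity of the orthogonal system -/

namespace AP2

open APReal

/-- An absolutely convergent series of characters is almost periodic. -/
theorem exists_fiberVector_eq_coe_of_summable {c : ℝ → ℂ} {w : ℝ} (hw : 0 < w) {l : ℝ}
    (hs : Summable fun p : ℤ => ‖c (l + w * p)‖ ^ 2)
    (h1 : Summable fun p : ℤ => ‖c (l + w * p)‖) :
    ∃ g : APReal, fiberVector c w l = (g : AP2) := by
  let S : Finset ℤ → APReal := fun s => ∑ p ∈ s, c (l + w * p) • char (l + w * p)
  have hS : ∀ s t, S s t = ∑ p ∈ s, c (l + w * p) * char (l + w * p) t := fun s t => by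
    simp only [S, sum_apply, smul_apply]
  have hu := tendstoUniformly_tsum (f := fun (p : ℤ) (t : ℝ) => c (l + w * p) * char (l + w * p) t)
    h1 fun p t => by
      rw [norm_mul, char_apply, Complex.norm_exp]
      simp
  rw [Metric.tendstoUniformly_iff] at hu
  have hG : IsBohrAP fun t => ∑' p : ℤ, c (l + w * p) * char (l + w * p) t := by
    refine isBohrAP_of_tendsto_uniformly fun ε hε => ?_
    obtain ⟨s, hs⟩ := (hu ε hε).exists
    refine ⟨S s, (S s).isBohrAP, fun t => ?_⟩
    rw [← dist_eq_norm, hS]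
    exact (hs t).le
  refine ⟨mk _ hG, tendsto_nhds_unique (hasSum_fiberVector hw hs) ?_⟩
  rw [Metric.tendsto_nhds]
  intro ε hε
  filter_upwards [hu (ε / 2) (half_pos hε)] with s hs
  have e : ∑ p ∈ s, c (l + w * p) • (char (l + w * p) : AP2) = (S s : AP2) := by
    refine ((map_sum (UniformSpace.Completion.toComplL (𝕜 := ℂ) (E := APReal))
      (fun p : ℤ => c (l + w * p) • char (l + w * p)) s).trans
        (Finset.sum_congr rfl fun p _ => ?_)).symm
    exact map_smul (UniformSpace.Completion.toComplL (𝕜 := ℂ) (E := APReal)) _ _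
  rw [e, dist_eq_norm, ← UniformSpace.Completion.coe_sub]
  refine (norm_coe_le (C := ε / 2) fun t => ?_).trans_lt (half_lt_self hε)
  rw [sub_apply, hS, mk_apply, ← dist_eq_norm, dist_comm]
  exact (hs t).le

end AP2

/-! ### Periodization and Poisson summation -/

theorem Function.Periodic.apMean_eq {f : ℝ → ℂ} {c : ℝ} (hf : Function.Periodic f c) (hc : 0 < c)
    (hcont : Continuous f) : apMean f = (c⁻¹ : ℝ) • ∫ t in (0 : ℝ)..c, f t := by
  have hap := hf.isBohrAP hc hcont
  refine (sub_eq_zero.1 (norm_le_zero_iff.1 (le_of_forall_pos_le_add fun ε hε => ?_))).symm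
  have h1 : Tendsto (fun n : ℕ => (n : ℝ) * c) atTop atTop :=
    tendsto_natCast_atTop_atTop.atTop_mul_const hc
  obtain ⟨n, hn, hn0⟩ := ((h1.eventually (hap.norm_average_sub_apMean_le hε)).and
    (eventually_gt_atTop 0)).exists
  have h2 := hf.intervalIntegral_add_zsmul_eq n 0 fun a b => hcont.intervalIntegrable a b
  have h3 := hn 0
  rw [zsmul_eq_mul, zsmul_eq_mul, zero_add, zero_add, Int.cast_natCast, Int.cast_natCast] at h2
  have hnc : (n : ℂ) ≠ 0 := by exact_mod_cast hn0.ne'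
  rw [zero_add] at h3 ⊢
  rw [h2] at h3
  convert! h3 using 3
  rw [Complex.real_smul, Complex.real_smul]
  push_cast
  field_simp

/-- The periodization of a function with respect to `αℤ`. -/
def periodize (α : ℝ) (Φ : ℝ → ℂ) (t : ℝ) : ℂ := ∑' k : ℤ, Φ (t + k * α)

theorem MemW0.mul_exp {φ : ℝ → ℂ} (hφ : MemW0 φ) (l : ℝ) :
    MemW0 fun t => φ t * Complex.exp (-(Complex.I * l * t)) := by
  refine ⟨by have := hφ.1; fun_prop, lt_of_le_of_lt (ENNReal.tsum_le_tsum fun k => ?_) hφ.2⟩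
  refine eLpNormEssSup_mono_enorm_ae (Eventually.of_forall fun x => ?_)
  rw [enorm_mul]
  have : ‖Complex.exp (-(Complex.I * l * (x - k : ℝ)))‖ₑ = 1 := by
    rw [← ofReal_norm, Complex.norm_exp]
    simp
  rw [this, mul_one]

theorem MemW0.continuous_periodize {Φ : ℝ → ℂ} (hΦ : MemW0 Φ) {α : ℝ} (hα : 0 < α) :
    Continuous (periodize α Φ) := by
  refine continuous_iff_continuousAt.2 fun x => ?_
  obtain ⟨u, hu, hle⟩ := hΦ.exists_summable_translates hα (|x| + 1)
  have h1 : ContinuousOn (periodize α Φ) (Set.Icc (x - 1) (x + 1)) :=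
    continuousOn_tsum (fun k => (hΦ.1.comp (continuous_add_const _)).continuousOn) hu
      fun k y hy => hle k y <| by
        have := abs_add_le x (y - x)
        rw [add_sub_cancel] at this
        have h2 : |y - x| ≤ 1 := abs_le.2 ⟨by linarith [hy.1], by linarith [hy.2]⟩
        linarith
  exact h1.continuousAt (Icc_mem_nhds (by linarith) (by linarith))

theorem periodic_periodize (α : ℝ) (Φ : ℝ → ℂ) : Function.Periodic (periodize α Φ) α := fun t => by
  rw [periodize, periodize, ← (Equiv.addRight (1 : ℤ)).tsum_eq fun k : ℤ => Φ (t + k * α)]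
  congr 1
  funext k
  congr 1
  simp
  ring

theorem MemW0.integral_periodize {Φ : ℝ → ℂ} (hΦ : MemW0 Φ) {α : ℝ} (hα : 0 < α) :
    ∫ t in (0 : ℝ)..α, periodize α Φ t = ∫ t, Φ t := by
  obtain ⟨u, hu, hle⟩ := hΦ.exists_summable_translates hα α
  have hmem : ∀ t ∈ Set.uIoc 0 α, |t| ≤ α := fun t ht => by
    rw [Set.uIoc_of_le hα.le] at ht
    rw [abs_of_pos ht.1]
    exact ht.2
  have h1 : HasSum (fun k : ℤ => ∫ t in (0 : ℝ)..α, Φ (t + k * α))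
      (∫ t in (0 : ℝ)..α, periodize α Φ t) :=
    intervalIntegral.hasSum_integral_of_dominated_convergence (fun k _ => u k)
      (fun k => (hΦ.1.comp (continuous_add_const _)).aestronglyMeasurable)
      (fun k => Eventually.of_forall fun t ht => hle k t (hmem t ht))
      (Eventually.of_forall fun t _ => hu) intervalIntegrable_const
      (Eventually.of_forall fun t ht =>
        (Summable.of_norm_bounded hu fun k => hle k t (hmem t ht)).hasSum)
  have h2 := (hΦ.integrable.comp_mul_left' hα.ne').hasSum_intervalIntegral_comp_add_int
  rw [Measure.integral_comp_mul_left Φ, abs_of_pos (inv_pos.2 hα)] at h2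
  have h3 : ∀ k : ℤ, ∫ x in (0 : ℝ)..1, Φ (α * (x + k))
      = (α⁻¹ : ℝ) • ∫ t in (0 : ℝ)..α, Φ (t + k * α) := fun k => by
    have := intervalIntegral.integral_comp_mul_left (a := 0) (b := 1)
      (fun t => Φ (t + k * α)) hα.ne'
    rw [mul_zero, mul_one] at this
    rw [← this]
    congr 1
    funext x
    congr 1
    ring
  simp only [h3] at h2
  have h4 := (h1.const_smul (α⁻¹ : ℝ)).unique h2
  exact smul_right_injective ℂ (inv_ne_zero hα.ne') h4

namespace AP2

open APReal

/-- Poisson summation in `AP₂(ℝ)`: the fibre vector and the function `G` have the same inner product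
with every character, and characters are complete. No pointwise convergence of the series is needed.
-/
theorem exists_fiberVector_eq_coe_of_memW0 {φ : ℝ → ℂ} (hφ : MemW0 φ) {α : ℝ} (hα : 0 < α)
    {l : ℝ} (hs : Summable fun p : ℤ => ‖angularFourier φ (l + 2 * Real.pi / α * p)‖ ^ 2) :
    ∃ g : APReal, fiberVector (angularFourier φ) (2 * Real.pi / α) l = (g : AP2) := by
  have hw : 0 < 2 * Real.pi / α := by positivity
  have hαc : (α : ℂ) ≠ 0 := by exact_mod_cast hα.ne'
  have hpi : (Real.pi : ℂ) ≠ 0 := by exact_mod_cast Real.pi_ne_zero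
  have hcont := (hφ.mul_exp l).continuous_periodize hα
  have hper := periodic_periodize α fun t => φ t * Complex.exp (-(Complex.I * l * t))
  set g := periodize α fun t => φ t * Complex.exp (-(Complex.I * l * t)) with hg
  have hgap : IsBohrAP g := hper.isBohrAP hα hcont
  -- The factor `α` cancels the `α⁻¹` in the mean of an `α`-periodic function.
  let G : APReal := mk _ ((isBohrAP_const α).mul (hgap.mul (isBohrAP_exp l)))
  refine ⟨G, sub_eq_zero.1 (eq_zero_of_inner_char_eq_zero fun μ => ?_)⟩
  rw [inner_sub_right, sub_eq_zero, UniformSpace.Completion.inner_coe, inner_char]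
  have hGt : ∀ t : ℝ, Complex.exp (-(Complex.I * μ * t)) * G t
      = α * (g t * Complex.exp (Complex.I * (l - μ : ℝ) * t)) := fun t => by
    have e : Complex.exp (Complex.I * (l - μ : ℝ) * t)
        = Complex.exp (Complex.I * l * t) * Complex.exp (-(Complex.I * μ * t)) := by
      rw [← Complex.exp_add]
      congr 1
      push_cast
      ring
    simp only [G, mk_apply, Pi.mul_apply, e]
    ring
  have hF : IsBohrAP fun t : ℝ => g t * Complex.exp (Complex.I * (l - μ : ℝ) * t) :=
    hgap.mul (isBohrAP_exp _)
  rw [funext hGt, hF.apMean_const_mul]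
  by_cases hex : ∃ p : ℤ, μ = l + 2 * Real.pi / α * p
  · obtain ⟨p, hp⟩ := hex
    have h1 : inner ℂ (char μ : AP2) (fiberVector (angularFourier φ) (2 * Real.pi / α) l)
        = angularFourier φ μ := by
      rw [← inner_conj_symm, hp, inner_fiberVector_char_self hw hs, Complex.conj_conj]
    -- On the fibre, `e^{i(l - μ)t}` is `α`-periodic and can be moved inside the periodization,
    -- which unfolds to the Fourier integral at `μ`.
    have h2 : (fun t : ℝ => g t * Complex.exp (Complex.I * (l - μ : ℝ) * t))
        = periodize α fun t => φ t * Complex.exp (-(Complex.I * μ * t)) := by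
      funext t
      rw [hg, periodize, periodize, ← tsum_mul_right]
      congr 1
      funext k
      rw [mul_assoc, ← Complex.exp_add]
      congr 1
      rw [Complex.exp_eq_exp_iff_exists_int]
      refine ⟨p * k, ?_⟩
      rw [hp]
      push_cast
      field_simp
      ring
    have hμ := hφ.mul_exp μ
    rw [h1, h2, (periodic_periodize α _).apMean_eq hα (hμ.continuous_periodize hα),
      hμ.integral_periodize hα, Complex.real_smul, Complex.ofReal_inv, mul_inv_cancel_left₀ hαc,
      angularFourier]
  · push Not at hex
    rw [← inner_conj_symm, inner_fiberVector_char_of_ne hw hs hex, map_zero,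
      hF.apMean_eq_zero_of_quasiperiodic (x := α)
        (ζ := Complex.exp (Complex.I * (l - μ : ℝ) * α)) ?_ fun t => ?_, mul_zero]
    · rw [Ne, Complex.exp_eq_one_iff]
      rintro ⟨n, hn⟩
      refine hex (-n) (Complex.ofReal_injective ?_)
      push_cast at hn ⊢
      have h1 : ((l : ℂ) - μ) * α = n * (2 * Real.pi) :=
        mul_left_cancel₀ Complex.I_ne_zero (by linear_combination hn)
      field_simp
      linear_combination -h1
    · rw [hper t, mul_left_comm, ← Complex.exp_add]
      congr 2
      push_cast
      ring

end AP2

namespace AP2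

/-- In the Fourier case inversion gives `ψ̂(ω) = 2π φ(-ω)`, and membership of `φ` in `W₀` makes
these samples absolutely summable along the fibre. -/
theorem exists_fiberVector_eq_coe {α : ℝ} (hα : 0 < α) {ψ : ℝ → ℂ} (hψ : Integrable ψ volume)
    (hψ' : ClassMemW0 ψ ∨ ClassMemFourierW0 ψ) {l : ℝ}
    (hs : Summable fun p : ℤ => ‖angularFourier ψ (l + 2 * Real.pi / α * p)‖ ^ 2) :
    ∃ g : APReal, fiberVector (angularFourier ψ) (2 * Real.pi / α) l = (g : AP2) := by
  have hw : 0 < 2 * Real.pi / α := by positivity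
  obtain (⟨φ, hφ, hψφ⟩ | ⟨φ, hφ, hψφ⟩) := hψ'
  · rw [angularFourier_congr_ae hψφ] at hs ⊢
    exact exists_fiberVector_eq_coe_of_memW0 hφ hα hs
  · have e : ∀ ω, angularFourier ψ ω = 2 * Real.pi * φ (-ω) := fun ω => by
      rw [angularFourier_congr_ae hψφ]
      exact angularFourier_angularFourier hφ.1 hφ.integrable (hψ.congr hψφ) ω
    refine exists_fiberVector_eq_coe_of_summable hw hs ?_
    obtain ⟨u, hu, hle⟩ := hφ.exists_summable_translates hw |l|
    refine Summable.of_nonneg_of_le (fun p => norm_nonneg _) (fun p => ?_)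
      ((hu.comp_injective neg_injective).mul_left ‖(2 * Real.pi : ℂ)‖)
    rw [e, norm_mul]
    gcongr
    have h1 := hle (-p) (-l) (by rw [abs_neg])
    refine le_of_eq_of_le ?_ h1
    congr 2
    push_cast
    ring

end AP2

/-! ### The main theorem -/

theorem mainTheorem6 (α : ℝ) (hα : 0 < α) (ψ : ℝ → ℂ) (hψ : Integrable ψ volume)
    (hC : (⨆ ω : ℝ, ∑' p : ℤ, ‖angularFourier ψ (ω + 2 * Real.pi / α * p)‖ₑ ^ 2) < ⊤) :
    ∃ h : Set.Ico (0 : ℝ) (2 * Real.pi / α) → AP2,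
      (∀ ω ω', ω ≠ ω' → inner ℂ (h ω) (h ω') = 0) ∧
      (∀ f : APReal, IsAPSeq (translateCoeff α ψ f) ∧
        ∃ r : ℝ, HasAPSeqNorm (translateCoeff α ψ f) r ∧
          HasSum (fun ω => ‖inner ℂ (h ω) (f : AP2)‖ ^ 2) (r ^ 2)) ∧
      (ClassMemW0 ψ ∨ ClassMemFourierW0 ψ → ∀ ω, ∃ g : APReal, h ω = (g : AP2)) := by
  have hw : 0 < 2 * Real.pi / α := by positivity
  let C : ENNReal := ⨆ ω : ℝ, ∑' p : ℤ, ‖angularFourier ψ (ω + 2 * Real.pi / α * p)‖ₑ ^ 2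
  have hle : ∀ l : ℝ, ∑' p : ℤ, ‖angularFourier ψ (l + 2 * Real.pi / α * p)‖ₑ ^ 2 ≤ C := fun l =>
    le_iSup (fun ω : ℝ => ∑' p : ℤ, ‖angularFourier ψ (ω + 2 * Real.pi / α * p)‖ₑ ^ 2) l
  have hreal : ∀ l : ℝ, ∀ p : ℤ, (‖angularFourier ψ (l + 2 * Real.pi / α * p)‖ₑ ^ 2).toReal
      = ‖angularFourier ψ (l + 2 * Real.pi / α * p)‖ ^ 2 := fun l p => by
    rw [ENNReal.toReal_pow, toReal_enorm]
  have hs : ∀ l : ℝ, Summable fun p : ℤ => ‖angularFourier ψ (l + 2 * Real.pi / α * p)‖ ^ 2 :=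
    fun l => (ENNReal.summable_toReal ((hle l).trans_lt hC).ne).congr (hreal l)
  let h : Set.Ico (0 : ℝ) (2 * Real.pi / α) → AP2 := fun i =>
    AP2.fiberVector (angularFourier ψ) (2 * Real.pi / α) i
  have horth : ∀ i j, i ≠ j → inner ℂ (h i) (h j) = 0 := fun i j hij =>
    AP2.inner_fiberVector_fiberVector hs i.2 j.2 fun e => hij (Subtype.ext e)
  -- By Parseval on each fibre, the uniform bound on the fibre sums is a uniform bound on the
  -- system, which is what makes `T` bounded.
  have hB : ∀ i, ‖h i‖ ^ 2 ≤ C.toReal := fun i => by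
    rw [AP2.norm_sq_fiberVector hw (hs i), ← tsum_congr (hreal i), ← ENNReal.tsum_toReal_eq
      fun p => ENNReal.pow_ne_top enorm_ne_top]
    exact ENNReal.toReal_mono hC.ne (hle i)
  let T := orthogonalCoeff horth ENNReal.toReal_nonneg hB
  have hTapp : ∀ f i, T f i = inner ℂ (h i) f :=
    orthogonalCoeff_apply horth ENNReal.toReal_nonneg hB
  have hT : ∀ μ i, T (APReal.char μ : AP2) i
      = if i = AP2.residue hw μ then (starRingEnd ℂ) (angularFourier ψ μ) else 0 := fun μ i => by
    rw [hTapp]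
    exact AP2.inner_fiberVector_char hw hs i μ
  clear_value T
  refine ⟨h, horth, fun f => ⟨isAPSeq_translateCoeff hα hψ f, ‖T (f : AP2)‖,
    AP2.hasAPSeqNorm_translateCoeff hα hψ hw T hT f, ?_⟩,
    fun hψ' i => AP2.exists_fiberVector_eq_coe hα hψ hψ' (hs i)⟩
  simpa only [hTapp] using hasSum_norm_sq_lp_two (T (f : AP2))
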